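/- \textbf{Setting.} Let $(K,d)$ be a complete metric space. A countable Markov system $\mathcal M=(K_{i(e)},w_e,p_e)_{e\in E}$ on $K$ consists of: countable sets $E$ and $N$; a partition $(K_j)_{j\in N}$ of $K$ into non-empty Borel sets; a surjective map $i:E\to N$ and a map $t:E\to N$; Borel maps $w_e:K_{i(e)}\to K_{t(e)}$ and $p_e:K_{i(e)}\to[0,1]$, where $p_e$ is not identically zero, such that $\sum_{e:\,i(e)=j}p_e(y)=1$ for all $y\in K_j$, $j\in N$. Extend $p_e$ to $K$ by zero and $w_e$ to a Borel map on $K$ arbitrarily, and put $Uf=\sum_{e\in E}p_e\,f\circ w_e$. Let $P(\mathcal M)$ be the set of invariant measures, i.e. of Borel probability measures $\mu$ on $K$ with $\int Uf\,d\mu=\int f\,d\mu$ for all bounded Borel $f:K\to[0,\infty)$. $\mathcal M$ is \emph{contractive} if there is $a\in(0,1)$ with $\sum_{e:\,i(e)=j}p_e(x)\,d(w_ex,w_ey)\le a\,d(x,y)$ for all $x,y\in K_j$, $j\in N$; it is \emph{uniformly continuous} if all restrictions $w_e|_{K_{i(e)}}$ and $p_e|_{K_{i(e)}}$ are uniformly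 continuous. It has a \emph{dominating Markov chain} if $\xi_j:=\sum_{e:\,i(e)=j}\sup_{K_j}p_e<\infty$ for all $j\in N$; then set $q_{jk}:=\xi_j^{-1}\sum_{e:\,i(e)=j,\,t(e)=k}\sup_{K_j}p_e$ and $c:=\sum_{k\in N}\sup_{j\in N}\xi_jq_{jk}$. Fix points $x_j\in K_j$, $j\in N$, and set $b:=\sup_{j\in N}\sup_{x\in K_j}\sum_{e:\,i(e)=j}p_e(x)\,d(w_e(x_{i(e)}),x_{t(e)})$. Let $\bar E=E\cup\{\infty\}$ be the one-point compactification of the discrete space $E$, with $w_\infty=\mathrm{id}$ and $i(\infty)=t(\infty)$ a fixed vertex, let $\bar\Sigma=\bar E^{\mathbb Z}$ with its Borel $\sigma$-algebra, let $S$ be the left shift, let $\Sigma_G=\{\sigma\in\bar\Sigma:\ \sigma_n\in E,\ i(\sigma_{n+1})=t(\sigma_n)\ \forall n\in\mathbb Z\}$, and let $\mathcal F$ be the $\sigma$-algebra generated by the cylinder sets $\{\sigma:\ \sigma_m=e_m,\dots,\sigma_0=e_0\}$, $m\le0$. Let $D$ be the set of all $\sigma\in\Sigma_G$ for which $\lim_{m\to-\infty}w_{\sigma_0}\circ\dots\circ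 w_{\sigma_m}(x_{i(\sigma_m)})$ exists; let $F(\sigma)$ be this limit for $\sigma\in D$ and $F(\sigma)=x_{t(\sigma_0)}$ otherwise. For uniformly continuous $\mathcal M$, let $\bar p_e$ be the continuous extension of $p_e|_{K_{i(e)}}$ to $\overline{K_{i(e)}}$, extended by zero to $K$, let $T_j=\{\sigma\in\Sigma_G:\ t(\sigma_0)=j\}$, and let $\tilde E(\mathcal M)$ be the set of all $S$-invariant Borel probability measures $\Lambda$ on $\bar\Sigma$ with $\Lambda(D)=1$ and $E_\Lambda(1_{\{\sigma_1=e\}}\mid\mathcal F)=(\bar p_e\circ F)\,1_{T_{i(e)}}$ $\Lambda$-a.e. for all $e\in E$. $\mathcal M$ is \emph{consistent} if the image measure $F(\Lambda)$ belongs to $P(\mathcal M)$ for every $\Lambda\in\tilde E(\mathcal M)$. \textbf{Statement.} Suppose that $\mathcal M$ is contractive, uniformly continuous and has a dominating Markov chain, and that, for some choice of the points $x_j\in K_j$, it is consistent and $b<\infty$. If $c<\infty$, then $P(\mathcal M)\neq\emptyset$, i.e. $\mathcal M$ has an invariant Borel probability measure. In particular, $P(\mathcal M)\neq\emptyset$ whenever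 the partition is finite, i.e. $N$ is finite. -/

import Mathlib

open MeasureTheory Filter Topology Set
open scoped ENNReal NNReal

noncomputable section

namespace RandomMarkov

universe u v w

/-- A countable Markov system on a complete metric space `K` with (countable) edge set `E` and
(countable) vertex set `N`. The maps and probability functions are already extended to all of `K`:
the probability functions by zero, and the maps by arbitrary Borel measurable extensions. -/
structure MarkovSystem (K : Type u) [MetricSpace K] [MeasurableSpace K]
    (E : Type v) (N : Type w) where
  /-- the vertex sets `K_j` -/
  part : N → Set K
  /-- a distinguished vertex (the vertex `1`), only used as a default value at `∞` -/
  base : N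
  /-- initial vertex of an edge -/
  i : E → N
  /-- terminal vertex of an edge -/
  t : E → N
  /-- the maps -/
  w : E → K → K
  /-- the probability functions -/
  p : E → K → ℝ
  part_measurable : ∀ j, MeasurableSet (part j)
  part_nonempty : ∀ j, (part j).Nonempty
  part_disjoint : ∀ j k, j ≠ k → Disjoint (part j) (part k)
  part_cover : ⋃ j, part j = Set.univ
  i_surjective : Function.Surjective i
  w_measurable : ∀ e, Measurable (w e)
  w_mapsTo : ∀ e, Set.MapsTo (w e) (part (i e)) (part (t e))
  p_measurable : ∀ e, Measurable (p e)
  p_nonneg : ∀ e x, 0 ≤ p e x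
  p_le_one : ∀ e x, p e x ≤ 1
  p_eq_zero : ∀ e x, x ∉ part (i e) → p e x = 0
  p_nontrivial : ∀ e, ∃ x ∈ part (i e), 0 < p e x
  p_sum : ∀ j, ∀ y ∈ part j, HasSum (fun e : {e : E // i e = j} => p e.1 y) 1

/-- One-point compactification of the discrete space `E`; its Borel σ-algebra consists of all
subsets when `E` is countable. -/
abbrev ExtAlphabet (E : Type v) : Type v := OnePoint E

instance extAlphabetMeasurableSpace (E : Type v) : MeasurableSpace (OnePoint E) := ⊤

/-- The code space of two-sided sequences, with the product σ-algebra
(for countable `E`, this is the Borel σ-algebra of the product topology). -/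
abbrev CodeSpace (E : Type v) : Type v := ℤ → ExtAlphabet E

/-- The left shift. -/
def shift {E : Type v} (σ : CodeSpace E) : CodeSpace E := fun n => σ (n + 1)

/-- The σ-algebra of the past: it is generated by the cylinder sets
`{σ | σ_m = e_m, …, σ_0 = e_0}`, `m ≤ 0`. -/
@[reducible] def past (E : Type v) : MeasurableSpace (CodeSpace E) :=
  MeasurableSpace.generateFrom
    {C | ∃ m : ℤ, m ≤ 0 ∧ ∃ e : CodeSpace E,
      C = {σ : CodeSpace E | ∀ k : ℤ, m ≤ k → k ≤ 0 → σ k = e k}}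

namespace MarkovSystem

variable {K : Type u} [MetricSpace K] [MeasurableSpace K] {E : Type v} {N : Type w}

/-- The Markov operator `U f = ∑ₑ pₑ · f ∘ wₑ`. -/
def U (M : MarkovSystem K E N) (f : K → ℝ≥0∞) (x : K) : ℝ≥0∞ :=
  ∑' e, ENNReal.ofReal (M.p e x) * f (M.w e x)

/-- The set `P(M)` of invariant Borel probability measures: those `μ` with
`∫ U f dμ = ∫ f dμ` for all bounded nonnegative real-valued Borel functions `f`. -/
def invariantMeasures (M : MarkovSystem K E N) : Set (Measure K) :=
  {μ | IsProbabilityMeasure μ ∧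
    ∀ f : K → ℝ≥0, Measurable f → (∃ C : ℝ≥0, ∀ x, f x ≤ C) →
      ∫⁻ x, M.U (fun y => (f y : ℝ≥0∞)) x ∂μ = ∫⁻ x, (f x : ℝ≥0∞) ∂μ}

/-- Contraction on average with rate `a ∈ (0,1)` on every vertex set. -/
def Contractive (M : MarkovSystem K E N) : Prop :=
  ∃ a : ℝ, 0 < a ∧ a < 1 ∧ ∀ j, ∀ x ∈ M.part j, ∀ y ∈ M.part j,
    ∑' e : {e : E // M.i e = j}, ENNReal.ofReal (M.p e.1 x) * edist (M.w e.1 x) (M.w e.1 y)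
      ≤ ENNReal.ofReal a * edist x y

/-- Uniform continuity of all restrictions of maps and probability functions to the vertex sets. -/
def IsUniformlyContinuous (M : MarkovSystem K E N) : Prop :=
  ∀ e, UniformContinuousOn (M.w e) (M.part (M.i e)) ∧
    UniformContinuousOn (M.p e) (M.part (M.i e))

/-- The constant `b`, for a choice `pt` of reference points `x_j ∈ K_j`. -/
def b (M : MarkovSystem K E N) (pt : N → K) : ℝ≥0∞ :=
  ⨆ j : N, ⨆ x ∈ M.part j, ∑' e : {e : E // M.i e = j},
    ENNReal.ofReal (M.p e.1 x) * edist (M.w e.1 (pt (M.i e.1))) (pt (M.t e.1))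

/-- `sup_{x ∈ K_{i(e)}} pₑ(x)`. -/
def supProb (M : MarkovSystem K E N) (e : E) : ℝ≥0∞ :=
  ⨆ x ∈ M.part (M.i e), ENNReal.ofReal (M.p e x)

/-- `ξ_j`. -/
def xi (M : MarkovSystem K E N) (j : N) : ℝ≥0∞ :=
  ∑' e : {e : E // M.i e = j}, M.supProb e.1

/-- Existence of a dominating Markov chain. -/
def HasDominatingChain (M : MarkovSystem K E N) : Prop := ∀ j, M.xi j < ∞

/-- The transition probabilities `q_{jk}` of the dominating Markov chain. -/
def q (M : MarkovSystem K E N) (j k : N) : ℝ≥0∞ :=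
  (M.xi j)⁻¹ * ∑' e : {e : E // M.i e = j ∧ M.t e = k}, M.supProb e.1

/-- The constant `c = ∑_k sup_j ξ_j q_{jk}`. -/
def c (M : MarkovSystem K E N) : ℝ≥0∞ := ∑' k, ⨆ j, M.xi j * M.q j k

/-- Initial vertex, extended to `∞`. -/
def iExt (M : MarkovSystem K E N) (e : ExtAlphabet E) : N := OnePoint.elim e M.base M.i

/-- Terminal vertex, extended to `∞`. -/
def tExt (M : MarkovSystem K E N) (e : ExtAlphabet E) : N := OnePoint.elim e M.base M.t

/-- The maps, extended by the identity at `∞`. -/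
def wExt (M : MarkovSystem K E N) (e : ExtAlphabet E) : K → K := OnePoint.elim e id M.w

/-- The path space `Σ_G`. -/
def pathSpace (M : MarkovSystem K E N) : Set (CodeSpace E) :=
  {σ | ∀ n : ℤ, (∃ e : E, σ n = (e : OnePoint E)) ∧ M.iExt (σ (n + 1)) = M.tExt (σ n)}

/-- `w_{σ_0} ∘ w_{σ_{-1}} ∘ ⋯ ∘ w_{σ_{-n}}`. -/
def backComp (M : MarkovSystem K E N) (σ : CodeSpace E) : ℕ → K → K
  | 0 => M.wExt (σ 0)
  | n + 1 => backComp M σ n ∘ M.wExt (σ (-((n : ℤ) + 1)))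

/-- `X_{-n}(σ) = w_{σ_0} ∘ ⋯ ∘ w_{σ_{-n}} (x_{i(σ_{-n})})`. -/
def X (M : MarkovSystem K E N) (pt : N → K) (n : ℕ) (σ : CodeSpace E) : K :=
  M.backComp σ n (pt (M.iExt (σ (-(n : ℤ)))))

/-- The set `D` of admissible codes along which the backward compositions converge. -/
def D (M : MarkovSystem K E N) (pt : N → K) : Set (CodeSpace E) :=
  {σ | σ ∈ M.pathSpace ∧ ∃ y, Tendsto (fun n => M.X pt n σ) atTop (𝓝 y)}

open Classical in
/-- The coding map `F`. -/
def F (M : MarkovSystem K E N) (pt : N → K) (σ : CodeSpace E) : K :=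
  if h : σ ∈ M.D pt then h.2.choose else pt (M.tExt (σ 0))

/-- `T_j`, the admissible codes whose zeroth edge ends at `j`. -/
def T (M : MarkovSystem K E N) (j : N) : Set (CodeSpace E) :=
  {σ | σ ∈ M.pathSpace ∧ M.tExt (σ 0) = j}

open Classical in
/-- The continuous extension of `pₑ|K_{i(e)}` to the closure of `K_{i(e)}`, extended by zero. -/
def pBar (M : MarkovSystem K E N) (e : E) (x : K) : ℝ :=
  if x ∈ closure (M.part (M.i e)) then extendFrom (M.part (M.i e)) (M.p e) x else 0

/-- The set `Ẽ(M)` of asymptotic states: shift invariant probability measures `Λ` on the code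
space with `Λ(D) = 1` and `E_Λ(1_{σ_1 = e} | past) = p̄ₑ ∘ F · 1_{T_{i(e)}}` a.e. for all `e`. -/
def asymptoticStates (M : MarkovSystem K E N) (pt : N → K) : Set (Measure (CodeSpace E)) :=
  {Λ | IsProbabilityMeasure Λ ∧ MeasurePreserving shift Λ Λ ∧ Λ (M.D pt) = 1 ∧
    ∀ e : E,
      Λ[({σ : CodeSpace E | σ 1 = (e : OnePoint E)}).indicator (fun _ => (1 : ℝ)) | past E]
        =ᵐ[Λ] (M.T (M.i e)).indicator (fun σ => M.pBar e (M.F pt σ))}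

/-- Consistency of a uniformly continuous Markov system: the image under the coding map of every
asymptotic state is an invariant measure. -/
def Consistent (M : MarkovSystem K E N) (pt : N → K) : Prop :=
  ∀ Λ ∈ M.asymptoticStates pt, Λ.map (M.F pt) ∈ M.invariantMeasures

end MarkovSystem

end RandomMarkov

end

/-!
Run the chain of positions from the base point and record the edges it takes. Contraction on
average and `b < ∞` make the position at any time reconstructible from the last `n` edges by a
backward composition, with a mean error that is geometrically small in `n`, uniformly in time. The
condition `c < ∞` keeps the chain in finitely many vertex sets, up to small probability, so the
edge process is tight and its time-averaged laws have a limit `Λ` along an ultrafilter of times.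
The averaging makes `Λ` shift invariant; summability of the errors makes the backward compositions
converge `Λ`-almost surely; and uniform continuity of the `p e` carries the law of the next edge
given the past over to the limit, where it becomes `pBar e ∘ F`. So `Λ` is an asymptotic state,
and consistency turns its image under `F` into an invariant measure.
-/

noncomputable section

namespace RandomMarkov

universe u v w

/-! ### Functions of finitely many coordinates -/

section Windows

variable {ι A X Y Z : Type*} {I : Finset ι}

theorem apply_updateFinset_restrict_of_dependsOn [DecidableEq ι] {f : (ι → A) → Y}
    (hf : DependsOn f I) (σ₀ σ : ι → A) :
    f (Function.updateFinset σ₀ I (I.restrict σ)) = f σ :=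
  hf fun j hj => by simp [Function.updateFinset, Finset.mem_coe.1 hj]

theorem dependsOn_indicator [Zero Y] {B : Set (ι → A)} {f : (ι → A) → Y} {s : Set ι}
    (hB : DependsOn (· ∈ B) s) (hf : DependsOn f s) : DependsOn (B.indicator f) s := by
  classical
  intro σ τ h
  simp only [indicator_apply, hf h]
  exact if_congr (hB h).to_iff rfl rfl

theorem dependsOn_indicator_one {B : Set (ι → A)} {s : Set ι} (hB : DependsOn (· ∈ B) s) :
    DependsOn (B.indicator (1 : (ι → A) → ℝ≥0∞)) s :=
  dependsOn_indicator hB fun _ _ _ => rfl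

theorem continuous_of_dependsOn [TopologicalSpace A] [DiscreteTopology A] [TopologicalSpace Y]
    {f : (ι → A) → Y} (hf : DependsOn f I) : Continuous f := by
  classical
  rcases isEmpty_or_nonempty (ι → A) with hZ | ⟨⟨σ₀⟩⟩
  · exact continuous_of_discreteTopology
  rw [show f = (fun τ => f (Function.updateFinset σ₀ I τ)) ∘ I.restrict from
    funext fun σ => (apply_updateFinset_restrict_of_dependsOn hf σ₀ σ).symm]
  exact continuous_of_discreteTopology.comp (Finset.continuous_restrict I)

variable [MeasurableSpace A] [DiscreteMeasurableSpace A] [Countable A] [MeasurableSpace Y]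
  [MeasurableSpace Z]

theorem measurable_comp_of_dependsOn {f : (ι → A) → Y} (hf : DependsOn f I) {s : Z → ι → A}
    (hs : ∀ j ∈ I, Measurable fun z => s z j) : Measurable fun z => f (s z) := by
  classical
  rcases isEmpty_or_nonempty Z with hZ | ⟨⟨z₀⟩⟩
  · exact measurable_of_empty _
  rw [show (fun z => f (s z)) =
      (fun τ => f (Function.updateFinset (s z₀) I τ)) ∘ fun z => I.restrict (s z) from
    funext fun z => (apply_updateFinset_restrict_of_dependsOn hf (s z₀) (s z)).symm]
  exact (measurable_of_countable _).comp (measurable_pi_lambda _ fun i => hs i i.2)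

theorem measurable_of_dependsOn {f : (ι → A) → Y} (hf : DependsOn f I) : Measurable f :=
  measurable_comp_of_dependsOn hf (s := id) fun j _ => measurable_pi_apply j

theorem measurableSet_of_dependsOn {B : Set (ι → A)} (hB : DependsOn (· ∈ B) I) :
    MeasurableSet B :=
  measurableSet_setOfPred.2 (measurable_of_dependsOn hB)

theorem measurable_uncurry_of_dependsOn [MeasurableSpace X] {f : X → (ι → A) → Y}
    (hm : ∀ σ, Measurable fun x => f x σ) (hd : ∀ x, DependsOn (f x) I) :
    Measurable fun z : X × (ι → A) => f z.1 z.2 := by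
  classical
  rcases isEmpty_or_nonempty (ι → A) with hZ | ⟨⟨σ₀⟩⟩
  · exact measurable_of_empty _
  rw [show (fun z : X × (ι → A) => f z.1 z.2) =
      (fun q : X × (I → A) => f q.1 (Function.updateFinset σ₀ I q.2)) ∘
        Prod.map id I.restrict from
    funext fun z => (apply_updateFinset_restrict_of_dependsOn (hd z.1) σ₀ z.2).symm]
  refine Measurable.comp ?_ (measurable_id.prodMap (Finset.measurable_restrict I))
  exact measurable_from_prod_countable_left fun τ => hm (Function.updateFinset σ₀ I τ)

end Windows

/-! ### Convergence on windows -/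

section Tightness

variable {ι : Type*} [Countable ι] {X : ι → Type*} [∀ i, TopologicalSpace (X i)]
  [∀ i, MeasurableSpace (X i)]

theorem isTightMeasureSet_of_forall_coordinate {S : Set (Measure (∀ i, X i))}
    (hS : ∀ i, ∀ ε : ℝ≥0∞, 0 < ε →
      ∃ C : Set (X i), IsCompact C ∧ ∀ μ ∈ S, μ {x | x i ∉ C} ≤ ε) :
    IsTightMeasureSet S := by
  rw [isTightMeasureSet_iff_exists_isCompact_measure_compl_le]
  intro ε hε
  obtain ⟨δ, hδ, hδε⟩ := ENNReal.exists_pos_sum_of_countable' hε.ne' ι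
  choose C hC hCδ using fun i => hS i (δ i) (hδ i)
  refine ⟨univ.pi C, isCompact_univ_pi hC, fun μ hμ => ?_⟩
  calc μ (univ.pi C)ᶜ ≤ μ (⋃ i, {x | x i ∉ C i}) := measure_mono fun x hx => by
        simpa [Set.mem_pi] using hx
    _ ≤ ∑' i, μ {x | x i ∉ C i} := measure_iUnion_le _
    _ ≤ ∑' i, δ i := ENNReal.tsum_le_tsum fun i => hCδ i μ hμ
    _ ≤ ε := hδε.le

end Tightness

section TendstoOnWindows

variable {ι A α : Type*} [MeasurableSpace A] {μ : α → Measure (ι → A)} {l : Filter α}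
  {Λ : Measure (ι → A)} {I : Finset ι}

/-- Convergence of measures on a product space, tested on the bounded functions of finitely many
coordinates. For a countable discrete alphabet this is weak convergence. -/
def TendstoOnWindows (μ : α → Measure (ι → A)) (l : Filter α) (Λ : Measure (ι → A)) : Prop :=
  ∀ (f : (ι → A) → ℝ≥0∞) (I : Finset ι) (C : ℝ≥0), DependsOn f I → (∀ σ, f σ ≤ C) →
    Tendsto (fun a => ∫⁻ σ, f σ ∂μ a) l (𝓝 (∫⁻ σ, f σ ∂Λ))

theorem tendstoOnWindows_of_tendsto [TopologicalSpace A] [DiscreteTopology A]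
    [OpensMeasurableSpace (ι → A)] {ν : α → ProbabilityMeasure (ι → A)}
    {ρ : ProbabilityMeasure (ι → A)} (h : Tendsto ν l (𝓝 ρ)) :
    TendstoOnWindows (fun a => (ν a : Measure (ι → A))) l ρ := by
  intro f I C hf hfC
  have hC : ∀ σ, f σ ≠ ∞ := fun σ => ne_top_of_le_ne_top ENNReal.coe_ne_top (hfC σ)
  let g : BoundedContinuousFunction (ι → A) ℝ≥0 := BoundedContinuousFunction.mkOfBound
    ⟨fun σ => (f σ).toNNReal, continuous_of_dependsOn fun σ τ h => by rw [hf h]⟩ C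
    fun σ τ => by
      have hle : ∀ σ, (f σ).toNNReal ≤ C := fun σ =>
        ENNReal.toNNReal_mono ENNReal.coe_ne_top (hfC σ)
      rw [NNReal.dist_eq]
      exact abs_sub_le_of_nonneg_of_le (NNReal.coe_nonneg _) (hle σ) (NNReal.coe_nonneg _) (hle τ)
  have hfg : ∀ σ, (g σ : ℝ≥0∞) = f σ := fun σ => ENNReal.coe_toNNReal (hC σ)
  simpa only [hfg] using ProbabilityMeasure.tendsto_iff_forall_lintegral_tendsto.1 h g

variable [DiscreteMeasurableSpace A] [Countable A]

theorem exists_tendstoOnWindows [Countable ι] [∀ a, IsProbabilityMeasure (μ a)]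
    (tight : ∀ j, ∀ ε : ℝ≥0∞, 0 < ε → ∃ S : Finset A, ∀ a, μ a {σ | σ j ∉ S} ≤ ε)
    (l : Ultrafilter α) :
    ∃ Λ : Measure (ι → A), IsProbabilityMeasure Λ ∧ TendstoOnWindows μ l Λ := by
  let _ : TopologicalSpace A := ⊥
  have _ : DiscreteTopology A := ⟨rfl⟩
  have _ : BorelSpace A := ⟨by
    rw [borel_eq_top_of_discrete]
    exact eq_top_iff.2 fun s _ => MeasurableSet.of_discrete⟩
  let ν : α → ProbabilityMeasure (ι → A) := fun a => ⟨μ a, inferInstance⟩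
  have hν : IsTightMeasureSet
      {((ρ : ProbabilityMeasure (ι → A)) : Measure (ι → A)) | ρ ∈ range ν} := by
    refine isTightMeasureSet_of_forall_coordinate fun j ε hε => ?_
    obtain ⟨S, hS⟩ := tight j ε hε
    refine ⟨S, S.finite_toSet.isCompact, ?_⟩
    rintro _ ⟨_, ⟨a, rfl⟩, rfl⟩
    exact hS a
  obtain ⟨Λ, -, hΛ⟩ := (isCompact_closure_of_isTightMeasureSet hν).ultrafilter_le_nhds (l.map ν)
    (le_principal_iff.2 (mem_map.2 (univ_mem' fun a => subset_closure ⟨a, rfl⟩)))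
  exact ⟨Λ, inferInstance, tendstoOnWindows_of_tendsto hΛ⟩

namespace TendstoOnWindows

theorem tendsto_measure (h : TendstoOnWindows μ l Λ) {B : Set (ι → A)}
    (hB : DependsOn (· ∈ B) I) : Tendsto (fun a => μ a B) l (𝓝 (Λ B)) := by
  simpa only [lintegral_indicator_one (measurableSet_of_dependsOn hB)] using
    h _ I 1 (dependsOn_indicator_one hB) (indicator_le_self' (by simp))

/-- Unlike in the definition, `f` may be unbounded: this is lower semicontinuity. -/
theorem lintegral_le_of_eventually_le [l.NeBot] (h : TendstoOnWindows μ l Λ)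
    {f : (ι → A) → ℝ≥0∞} (hf : DependsOn f I) {C : ℝ≥0∞}
    (hC : ∀ᶠ a in l, ∫⁻ σ, f σ ∂μ a ≤ C) : ∫⁻ σ, f σ ∂Λ ≤ C := by
  have hmin : ∀ m : ℕ, DependsOn (fun σ => min (f σ) m) (I : Set ι) := fun m σ τ hστ => by
    beta_reduce
    rw [hf hστ]
  calc ∫⁻ σ, f σ ∂Λ = ∫⁻ σ, ⨆ m : ℕ, min (f σ) m ∂Λ := by
        simp only [← inf_iSup_eq, ENNReal.iSup_natCast, inf_top_eq]
    _ = ⨆ m : ℕ, ∫⁻ σ, min (f σ) m ∂Λ :=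
        lintegral_iSup (fun m => measurable_of_dependsOn (hmin m)) fun i j hij σ =>
          min_le_min_left _ (Nat.cast_le.2 hij)
    _ ≤ C := iSup_le fun m => by
        refine le_of_tendsto (h _ I m (hmin m) fun σ => min_le_right _ _) ?_
        filter_upwards [hC] with a ha
        exact (lintegral_mono fun σ => min_le_left _ _).trans ha

theorem ae_of_eventually_ae [l.NeBot] (h : TendstoOnWindows μ l Λ) {P : (ι → A) → Prop}
    (hP : DependsOn P I) (hae : ∀ᶠ a in l, ∀ᵐ σ ∂μ a, P σ) : ∀ᵐ σ ∂Λ, P σ := by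
  have hB : DependsOn (· ∈ {σ | ¬ P σ}) (I : Set ι) := fun σ τ hστ => congrArg Not (hP hστ)
  refine le_antisymm (le_of_tendsto (h.tendsto_measure hB) ?_) zero_le
  filter_upwards [hae] with a ha
  exact ha.le

end TendstoOnWindows

end TendstoOnWindows

section Measures

variable {Ω : Type*} {m m₀ : MeasurableSpace Ω} {μ : Measure Ω}

theorem eq_of_forall_measurableCylinders_le {ι : Type*} {X : ι → Type*}
    [∀ i, MeasurableSpace (X i)] {μ ν : Measure (∀ i, X i)} [IsProbabilityMeasure μ]
    [IsProbabilityMeasure ν] (h : ∀ B ∈ measurableCylinders X, μ B ≤ ν B) : μ = ν := by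
  refine ext_of_generate_finite (measurableCylinders X) generateFrom_measurableCylinders.symm
    isPiSystem_measurableCylinders (fun B hB => (h B hB).antisymm ?_) (by simp)
  have hBm := MeasurableSet.of_mem_measurableCylinders hB
  refine (ENNReal.add_le_add_iff_right (measure_ne_top ν Bᶜ)).1 ?_
  calc ν B + ν Bᶜ = μ B + μ Bᶜ := by rw [prob_add_prob_compl hBm, prob_add_prob_compl hBm]
    _ ≤ μ B + ν Bᶜ := add_le_add_right (h _ (compl_mem_measurableCylinders hB)) _

theorem setLIntegral_le_setLIntegral_add [IsProbabilityMeasure μ] {f g d : Ω → ℝ≥0∞} {ε B : ℝ≥0∞}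
    (hd : Measurable d) (h : ∀ᵐ ω ∂μ, f ω ≤ g ω + (ε + B * d ω)) (s : Set Ω) :
    ∫⁻ ω in s, f ω ∂μ ≤ ∫⁻ ω in s, g ω ∂μ + (ε + B * ∫⁻ ω, d ω ∂μ) :=
  calc ∫⁻ ω in s, f ω ∂μ ≤ ∫⁻ ω in s, g ω + (ε + B * d ω) ∂μ :=
        lintegral_mono_ae (ae_restrict_of_ae h)
    _ = ∫⁻ ω in s, g ω ∂μ + ∫⁻ ω in s, ε + B * d ω ∂μ :=
        lintegral_add_right _ ((hd.const_mul B).const_add ε)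
    _ ≤ ∫⁻ ω in s, g ω ∂μ + ∫⁻ ω, ε + B * d ω ∂μ := by
        gcongr
        exact Measure.restrict_le_self
    _ = ∫⁻ ω in s, g ω ∂μ + (ε + B * ∫⁻ ω, d ω ∂μ) := by
        rw [lintegral_add_left measurable_const, lintegral_const_mul _ hd, lintegral_const,
          measure_univ, mul_one]

theorem aestronglyMeasurable_of_forall_measurable_of_tendsto_ae {f : ℕ → Ω → ℝ} {g : Ω → ℝ}
    (hf : ∀ n, Measurable[m] (f n))
    (h : ∀ᵐ ω ∂μ, Tendsto (fun n => f n ω) atTop (𝓝 (g ω))) : AEStronglyMeasurable[m] g μ := by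
  refine ⟨_, (Measurable.limsup hf).stronglyMeasurable, ?_⟩
  filter_upwards [h] with ω hω
  exact hω.limsup_eq.symm

theorem condExp_indicator_ae_eq_of_isPiSystem [IsFiniteMeasure μ] (hm : m ≤ m₀)
    {C : Set (Set Ω)} (hC : m = MeasurableSpace.generateFrom C) (hpi : IsPiSystem C) {B : Set Ω}
    (hB : MeasurableSet[m₀] B) {g : Ω → ℝ} (hgm : AEStronglyMeasurable[m] g μ)
    (hg : 0 ≤ᵐ[μ] g) (huniv : μ B = ∫⁻ ω, ENNReal.ofReal (g ω) ∂μ)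
    (h : ∀ s ∈ C, μ (s ∩ B) = ∫⁻ ω in s, ENNReal.ofReal (g ω) ∂μ) :
    μ[B.indicator (fun _ => (1 : ℝ)) | m] =ᵐ[μ] g := by
  have hsB : ∀ s, MeasurableSet[m] s → μ (s ∩ B) = ∫⁻ ω in s, ENNReal.ofReal (g ω) ∂μ := by
    intro s hs
    rw [← Measure.restrict_apply (hm s hs), ← withDensity_apply _ (hm s hs)]
    refine ext_on_measurableSpace_of_generate_finite m₀ C (fun t ht => ?_) hm hC hpi ?_ hs
    · have htm : MeasurableSet[m] t := hC ▸ MeasurableSpace.measurableSet_generateFrom ht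
      rw [Measure.restrict_apply (hm t htm), withDensity_apply _ (hm t htm), h t ht]
    · rw [Measure.restrict_apply_univ, withDensity_apply _ MeasurableSet.univ,
        Measure.restrict_univ, huniv]
  have hgi : Integrable g μ := ⟨hgm.mono hm, by
    rw [hasFiniteIntegral_iff_ofReal hg, ← huniv]
    exact measure_lt_top μ B⟩
  refine (ae_eq_condExp_of_forall_setIntegral_eq hm ((integrable_const (1 : ℝ)).indicator hB)
    (fun s _ _ => hgi.integrableOn) (fun s hs _ => ?_) hgm).symm
  rw [integral_eq_lintegral_of_nonneg_ae (ae_restrict_of_ae hg) (hgm.mono hm).restrict,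
    ← hsB s hs, setIntegral_indicator hB]
  simp [Measure.real]

end Measures

/-! ### The code space -/

section CodeSpace

variable {E : Type v}

instance : DiscreteMeasurableSpace (OnePoint E) := ⟨fun _ => trivial⟩

instance [Countable E] : Countable (OnePoint E) := inferInstanceAs (Countable (Option E))

/-- The history at coordinates `j ≤ 0` extended by a new edge, recentred so that the new edge sits
at coordinate `0`. -/
def snoc (σ : CodeSpace E) (e : E) : CodeSpace E :=
  fun j => if j = 0 then (e : OnePoint E) else σ (j + 1)

@[simp]
theorem snoc_zero (σ : CodeSpace E) (e : E) : snoc σ e 0 = e := if_pos rfl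

theorem snoc_of_ne (σ : CodeSpace E) (e : E) {j : ℤ} (hj : j ≠ 0) : snoc σ e j = σ (j + 1) :=
  if_neg hj

theorem measurable_snoc (e : E) : Measurable fun σ : CodeSpace E => snoc σ e := by
  refine measurable_pi_lambda _ fun j => ?_
  rcases eq_or_ne j 0 with rfl | hj
  · simp only [snoc_zero, measurable_const]
  · simpa only [snoc_of_ne _ _ hj] using measurable_pi_apply (j + 1)

/-- The right shift by `s` steps: a history recorded up to coordinate `0` is seen from `s` steps
before its last edge. -/
def delay (s : ℕ) (σ : CodeSpace E) : CodeSpace E := fun j => σ (j - s)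

@[simp]
theorem delay_zero (σ : CodeSpace E) : delay 0 σ = σ := by
  funext j
  simp [delay]

theorem measurable_delay (s : ℕ) : Measurable (delay (E := E) s) :=
  measurable_pi_lambda _ fun _ => measurable_pi_apply _

theorem shift_delay_succ (s : ℕ) (σ : CodeSpace E) : shift (delay (s + 1) σ) = delay s σ := by
  funext j
  simp only [shift, delay]
  congr 1
  push_cast
  ring

theorem delay_succ_snoc_self (s : ℕ) (σ : CodeSpace E) (e : E) :
    delay (s + 1) (snoc σ e) (s + 1) = e := by
  simp [delay]

theorem delay_succ_snoc_of_le {s : ℕ} {j : ℤ} (hj : j ≤ s) (σ : CodeSpace E) (e : E) :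
    delay (s + 1) (snoc σ e) j = delay s σ j := by
  rw [delay, snoc_of_ne _ _ (by omega), delay]
  congr 1
  push_cast
  ring

theorem measurable_history {X : Type*} [MeasurableSpace X] (j : ℤ) :
    Measurable fun z : X × CodeSpace E => z.2 j :=
  (measurable_pi_apply j).comp measurable_snd

theorem measurable_delay_history {X : Type*} [MeasurableSpace X] (s : ℕ) :
    Measurable fun z : X × CodeSpace E => delay s z.2 :=
  (measurable_delay s).comp measurable_snd

theorem measurable_shift : Measurable (shift : CodeSpace E → CodeSpace E) :=
  measurable_pi_lambda _ fun _ => measurable_pi_apply _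

theorem coe_Icc_zero_subset_Iic (j : ℤ) : ((Finset.Icc j 0 : Finset ℤ) : Set ℤ) ⊆ Iic 0 := by
  rw [Finset.coe_Icc]
  exact Icc_subset_Iic_self

theorem dependsOn_pastCylinder (m : ℤ) (e : CodeSpace E) :
    DependsOn (· ∈ {σ : CodeSpace E | ∀ k : ℤ, m ≤ k → k ≤ 0 → σ k = e k})
      (Finset.Icc m 0 : Finset ℤ) := by
  intro σ τ h
  refine propext (forall_congr' fun k => forall_congr' fun hk => forall_congr' fun hk' => ?_)
  rw [h k (by simp [hk, hk'])]

theorem isPiSystem_pastCylinders (E : Type v) :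
    IsPiSystem {C | ∃ m : ℤ, m ≤ 0 ∧ ∃ e : CodeSpace E,
      C = {σ : CodeSpace E | ∀ k : ℤ, m ≤ k → k ≤ 0 → σ k = e k}} := by
  rintro _ ⟨m, hm, e, rfl⟩ _ ⟨m', -, e', rfl⟩ ⟨τ, hτ, hτ'⟩
  refine ⟨min m m', (min_le_left _ _).trans hm, τ, Set.ext fun σ => ⟨?_, fun h => ⟨?_, ?_⟩⟩⟩
  · rintro ⟨h, h'⟩ k hk hk0
    rcases min_le_iff.1 hk with hmk | hmk
    · rw [h k hmk hk0, hτ k hmk hk0]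
    · rw [h' k hmk hk0, hτ' k hmk hk0]
  · exact fun k hk hk0 => (h k ((min_le_left _ _).trans hk) hk0).trans (hτ k hk hk0)
  · exact fun k hk hk0 => (h k ((min_le_right _ _).trans hk) hk0).trans (hτ' k hk hk0)

variable [Countable E]

theorem past_le : past E ≤ (MeasurableSpace.pi : MeasurableSpace (CodeSpace E)) := by
  refine MeasurableSpace.generateFrom_le ?_
  rintro _ ⟨m, -, e, rfl⟩
  exact measurableSet_of_dependsOn (dependsOn_pastCylinder m e)

theorem measurable_past_apply {j : ℤ} (hj : j ≤ 0) :
    Measurable[past E] fun σ : CodeSpace E => σ j := by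
  let _ : MeasurableSpace (CodeSpace E) := past E
  have hrestrict : Measurable fun σ : CodeSpace E => (Finset.Icc j 0).restrict σ := by
    refine measurable_to_countable' fun τ => MeasurableSpace.measurableSet_generateFrom
      ⟨j, hj, Function.updateFinset (fun _ => OnePoint.infty) _ τ, ?_⟩
    ext σ
    simp +contextual [funext_iff, Function.updateFinset]
  exact (measurable_pi_apply ⟨j, Finset.mem_Icc.2 ⟨le_rfl, hj⟩⟩).comp hrestrict

theorem measurable_past_of_dependsOn {Y : Type*} [MeasurableSpace Y] {I : Finset ℤ}
    {f : CodeSpace E → Y} (hf : DependsOn f I) (hI : (I : Set ℤ) ⊆ Iic 0) :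
    Measurable[past E] f :=
  let _ : MeasurableSpace (CodeSpace E) := past E
  measurable_comp_of_dependsOn hf (s := id) fun _ hj => measurable_past_apply (hI hj)

end CodeSpace

namespace MarkovSystem

variable {K : Type u} [MetricSpace K] [MeasurableSpace K] {E : Type v} {N : Type w}
  {M : MarkovSystem K E N}

section System

variable (M) in
theorem exists_mem_part (x : K) : ∃ j, x ∈ M.part j :=
  mem_iUnion.1 (M.part_cover ▸ mem_univ x)

theorem eq_of_mem_part {x : K} {j k : N} (hj : x ∈ M.part j) (hk : x ∈ M.part k) : j = k := by
  by_contra h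
  exact Set.disjoint_left.1 (M.part_disjoint j k h) hj hk

theorem tsum_eq_tsum_subtype {x : K} {j : N} (hx : x ∈ M.part j) (g : E → ℝ≥0∞) :
    ∑' e, ENNReal.ofReal (M.p e x) * g e =
      ∑' e : {e : E // M.i e = j}, ENNReal.ofReal (M.p e.1 x) * g e.1 := by
  refine (tsum_subtype_eq_of_support_subset (s := {e : E | M.i e = j}) fun e he => ?_).symm
  by_contra h
  exact he (by simp [M.p_eq_zero e x fun h' => h (eq_of_mem_part h' hx)])

theorem tsum_ofReal_p_mul_le {x : K} {f g : E → ℝ≥0∞} (h : ∀ e, x ∈ M.part (M.i e) → f e ≤ g e) :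
    ∑' e, ENNReal.ofReal (M.p e x) * f e ≤ ∑' e, ENNReal.ofReal (M.p e x) * g e := by
  refine ENNReal.tsum_le_tsum fun e => ?_
  by_cases he : x ∈ M.part (M.i e)
  · exact mul_le_mul_right (h e he) _
  · simp [M.p_eq_zero e x he]

variable (M) in
theorem tsum_ofReal_p (x : K) : ∑' e, ENNReal.ofReal (M.p e x) = 1 := by
  obtain ⟨j, hj⟩ := M.exists_mem_part x
  have h := tsum_eq_tsum_subtype hj fun _ => 1
  simp only [mul_one] at h
  rw [h, ← ENNReal.ofReal_tsum_of_nonneg (fun e => M.p_nonneg _ _) (M.p_sum j x hj).summable,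
    (M.p_sum j x hj).tsum_eq, ENNReal.ofReal_one]

theorem ofReal_p_le_supProb {e : E} {x : K} (hx : x ∈ M.part (M.i e)) :
    ENNReal.ofReal (M.p e x) ≤ M.supProb e :=
  le_iSup₂_of_le (f := fun x _ => ENNReal.ofReal (M.p e x)) x hx le_rfl

theorem tsum_edist_le_b {x : K} (pt : N → K) :
    ∑' e, ENNReal.ofReal (M.p e x) * edist (M.w e (pt (M.i e))) (pt (M.t e)) ≤ M.b pt := by
  obtain ⟨j, hj⟩ := M.exists_mem_part x
  rw [tsum_eq_tsum_subtype hj]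
  exact le_iSup_of_le j (le_iSup₂_of_le x hj le_rfl)

theorem Contractive.exists_tsum_edist_le (h : M.Contractive) :
    ∃ a : ℝ≥0∞, a < 1 ∧ ∀ j, ∀ x ∈ M.part j, ∀ y ∈ M.part j,
      ∑' e, ENNReal.ofReal (M.p e x) * edist (M.w e x) (M.w e y) ≤ a * edist x y := by
  obtain ⟨a, -, ha, hle⟩ := h
  refine ⟨ENNReal.ofReal a, ENNReal.ofReal_lt_one.2 ha, fun j x hx y hy => ?_⟩
  rw [tsum_eq_tsum_subtype hx]
  exact hle j x hx y hy

end System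

/-! ### Backward compositions -/

section BackwardCompositions

@[simp] theorem iExt_coe (e : E) : M.iExt (e : OnePoint E) = M.i e := rfl

@[simp] theorem tExt_coe (e : E) : M.tExt (e : OnePoint E) = M.t e := rfl

@[simp] theorem wExt_coe (e : E) : M.wExt (e : OnePoint E) = M.w e := rfl

theorem wExt_mapsTo (e : OnePoint E) :
    MapsTo (M.wExt e) (M.part (M.iExt e)) (M.part (M.tExt e)) := by
  induction e using OnePoint.rec with
  | infty => exact mapsTo_id _
  | coe e => exact M.w_mapsTo e

variable (M) in
/-- The past of `σ` is a path, where `∞` is regarded as a loop at the base vertex. -/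
def PastPath (σ : CodeSpace E) : Prop := ∀ j : ℤ, j < 0 → M.iExt (σ (j + 1)) = M.tExt (σ j)

theorem pastPath_infty : M.PastPath fun _ => OnePoint.infty := fun _ _ => rfl

theorem PastPath.snoc {σ : CodeSpace E} (h : M.PastPath σ) {e : E} (he : M.i e = M.tExt (σ 0)) :
    M.PastPath (snoc σ e) := by
  intro j hj
  rw [snoc_of_ne _ _ hj.ne]
  rcases eq_or_ne (j + 1) 0 with hj1 | hj1
  · rw [hj1, snoc_zero, iExt_coe, he]
  · rw [snoc_of_ne _ _ hj1]
    exact h (j + 1) (by omega)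

theorem PastPath.backComp_mapsTo {σ : CodeSpace E} (h : M.PastPath σ) (n : ℕ) :
    MapsTo (M.backComp σ n) (M.part (M.iExt (σ (-(n : ℤ))))) (M.part (M.tExt (σ 0))) := by
  induction n with
  | zero => simpa [backComp] using M.wExt_mapsTo (σ 0)
  | succ n ih =>
    have hn := h (-((n : ℤ) + 1)) (by omega)
    rw [show -((n : ℤ) + 1) + 1 = -(n : ℤ) by ring] at hn
    rw [backComp, Nat.cast_succ]
    refine ih.comp ?_
    rw [hn]
    exact M.wExt_mapsTo _

variable {pt : N → K}

theorem PastPath.X_mem {σ : CodeSpace E} (h : M.PastPath σ) (hpt : ∀ j, pt j ∈ M.part j) (n : ℕ) :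
    M.X pt n σ ∈ M.part (M.tExt (σ 0)) :=
  h.backComp_mapsTo n (hpt _)

theorem backComp_snoc (σ : CodeSpace E) (e : E) (n : ℕ) :
    M.backComp (snoc σ e) (n + 1) = M.w e ∘ M.backComp σ n := by
  induction n with
  | zero =>
    simp only [backComp, snoc_zero, wExt_coe, Nat.cast_zero]
    rw [snoc_of_ne _ _ (by omega)]
    rfl
  | succ n ih =>
    rw [backComp, ih, backComp, snoc_of_ne _ _ (by omega), Function.comp_assoc]
    congr 4

theorem X_zero_snoc (σ : CodeSpace E) (e : E) : M.X pt 0 (snoc σ e) = M.w e (pt (M.i e)) := by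
  simp [X, backComp]

theorem X_succ_snoc (σ : CodeSpace E) (e : E) (n : ℕ) :
    M.X pt (n + 1) (snoc σ e) = M.w e (M.X pt n σ) := by
  rw [X, backComp_snoc, snoc_of_ne _ _ (by omega), Function.comp_apply, X,
    show -((n + 1 : ℕ) : ℤ) + 1 = -n by push_cast; ring]

theorem X_infty (n : ℕ) : M.X pt n (fun _ => OnePoint.infty) = pt M.base := by
  have hid : M.backComp (fun _ => OnePoint.infty) n = id := by
    induction n with
    | zero => rfl
    | succ n ih => rw [backComp, ih]; rfl
  rw [X, hid]
  rfl

theorem backComp_congr {σ τ : CodeSpace E} {n : ℕ}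
    (h : ∀ j : ℤ, -(n : ℤ) ≤ j → j ≤ 0 → σ j = τ j) : M.backComp σ n = M.backComp τ n := by
  induction n with
  | zero => rw [backComp, backComp, h 0 (by simp) le_rfl]
  | succ n ih =>
    rw [backComp, backComp, ih fun j hj => h j (by push_cast; omega),
      h _ (by push_cast; omega) (by omega)]

theorem dependsOn_X (n : ℕ) : DependsOn (M.X pt n) (Finset.Icc (-(n : ℤ)) 0 : Finset ℤ) := by
  intro σ τ h
  have hj : ∀ j : ℤ, -(n : ℤ) ≤ j → j ≤ 0 → σ j = τ j := fun j h1 h2 => h j (by simp [h1, h2])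
  rw [X, X, backComp_congr hj, hj _ le_rfl (by omega)]

theorem dependsOn_edist_X (n : ℕ) :
    DependsOn (fun σ => edist (M.X pt n σ) (M.X pt (n + 1) σ))
      (Finset.Icc (-((n + 1 : ℕ) : ℤ)) 0 : Finset ℤ) := by
  have hsub : (Finset.Icc (-(n : ℤ)) 0 : Set ℤ) ⊆ Finset.Icc (-((n + 1 : ℕ) : ℤ)) 0 :=
    Finset.coe_subset.2 (Finset.Icc_subset_Icc_left (by push_cast; omega))
  intro σ τ h
  beta_reduce
  rw [(dependsOn_X n).mono hsub h, dependsOn_X (n + 1) h]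

theorem dependsOn_pt_tExt : DependsOn (fun σ : CodeSpace E => pt (M.tExt (σ 0)))
    (({0} : Finset ℤ) : Set ℤ) := fun σ τ h => by
  beta_reduce
  rw [h 0 (by simp)]

end BackwardCompositions

/-! ### The chain of positions and histories -/

section Chain

variable (M) in
/-- One step of the Markov chain on pairs (position, history), acting on laws. -/
def step (ν : Measure (K × CodeSpace E)) : Measure (K × CodeSpace E) :=
  Measure.sum fun e : E => (ν.withDensity fun z => ENNReal.ofReal (M.p e z.1)).map
    fun z => (M.w e z.1, snoc z.2 e)

theorem measurable_move (e : E) :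
    Measurable fun z : K × CodeSpace E => (M.w e z.1, snoc z.2 e) :=
  ((M.w_measurable e).comp measurable_fst).prodMk ((measurable_snoc e).comp measurable_snd)

theorem measurable_weight (e : E) :
    Measurable fun z : K × CodeSpace E => ENNReal.ofReal (M.p e z.1) :=
  ((M.p_measurable e).comp measurable_fst).ennreal_ofReal

variable (M) in
/-- The law at time `n` of the chain started at the base point with history `∞`. -/
def chain (pt : N → K) : ℕ → Measure (K × CodeSpace E)
  | 0 => Measure.dirac (pt M.base, fun _ => OnePoint.infty)
  | n + 1 => M.step (chain pt n)

variable {pt : N → K} {ν : Measure (K × CodeSpace E)}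

theorem ae_step {P : K × CodeSpace E → Prop} (hP : MeasurableSet {z | P z})
    (h : ∀ᵐ z ∂ν, ∀ e, z.1 ∈ M.part (M.i e) → P (M.w e z.1, snoc z.2 e)) :
    ∀ᵐ z ∂M.step ν, P z := by
  refine (Measure.ae_sum_iff' hP).2 fun e =>
    (ae_map_iff (measurable_move e).aemeasurable hP).2 <|
      (ae_withDensity_iff (measurable_weight e)).2 ?_
  filter_upwards [h] with z hz hp
  refine hz e ?_
  by_contra he
  exact hp (by rw [M.p_eq_zero e _ he, ENNReal.ofReal_zero])

theorem ae_ne_infty {n : ℕ} {j : ℤ} (hj : j ≤ 0) (hn : -(n : ℤ) < j) :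
    ∀ᵐ z ∂M.chain pt n, z.2 j ≠ OnePoint.infty := by
  induction n generalizing j with
  | zero => simp at hn; omega
  | succ n ih =>
    refine ae_step (measurable_history j (.of_discrete (s := {a | a ≠ OnePoint.infty}))) ?_
    rcases eq_or_ne j 0 with rfl | hj0
    · exact ae_of_all _ fun z e _ => by simp
    · filter_upwards [ih (j := j + 1) (by omega) (by push_cast at hn; omega)] with z hz e _
      rwa [snoc_of_ne _ _ hj0]

variable [Countable E]

theorem lintegral_step {f : K × CodeSpace E → ℝ≥0∞} (hf : Measurable f) :
    ∫⁻ z, f z ∂M.step ν =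
      ∫⁻ z, ∑' e, ENNReal.ofReal (M.p e z.1) * f (M.w e z.1, snoc z.2 e) ∂ν := by
  have hmeas : ∀ e, Measurable fun z : K × CodeSpace E =>
      ENNReal.ofReal (M.p e z.1) * f (M.w e z.1, snoc z.2 e) := fun e =>
    (measurable_weight e).mul (hf.comp (measurable_move e))
  rw [step, lintegral_sum_measure, lintegral_tsum fun e => (hmeas e).aemeasurable]
  refine tsum_congr fun e => ?_
  rw [lintegral_map hf (measurable_move e)]
  exact lintegral_withDensity_eq_lintegral_mul _ (measurable_weight e)
    (hf.comp (measurable_move e))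

theorem step_apply {A : Set (K × CodeSpace E)} (hA : MeasurableSet A) :
    M.step ν A =
      ∫⁻ z, ∑' e, ENNReal.ofReal (M.p e z.1) * A.indicator 1 (M.w e z.1, snoc z.2 e) ∂ν := by
  rw [← lintegral_indicator_one hA, lintegral_step (measurable_one.indicator hA)]

instance isProbabilityMeasure_chain (n : ℕ) : IsProbabilityMeasure (M.chain pt n) := by
  induction n with
  | zero => exact Measure.dirac.isProbabilityMeasure
  | succ n ih =>
    constructor
    rw [chain, ← lintegral_one, lintegral_step measurable_const]
    simp [tsum_ofReal_p]

variable (M) in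
/-- The position lies in the vertex set where the history ends, and the history is a path. -/
def Compatible (z : K × CodeSpace E) : Prop := z.1 ∈ M.part (M.tExt (z.2 0)) ∧ M.PastPath z.2

theorem measurableSet_compatible : MeasurableSet {z | M.Compatible z} := by
  have hmem : Measurable fun z : K × CodeSpace E => z.1 ∈ M.part (M.tExt (z.2 0)) :=
    measurable_uncurry_of_dependsOn (I := {0})
      (f := fun x (σ : CodeSpace E) => x ∈ M.part (M.tExt (σ 0)))
      (fun σ => measurableSet_setOfPred.1 (M.part_measurable _))
      (fun x σ τ h => by beta_reduce; rw [h 0 (by simp)])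
  have hpath : ∀ j : ℤ, Measurable fun z : K × CodeSpace E =>
      (j < 0 → M.iExt (z.2 (j + 1)) = M.tExt (z.2 j)) := fun j =>
    measurable_comp_of_dependsOn (I := {j, j + 1})
      (f := fun σ : CodeSpace E => (j < 0 → M.iExt (σ (j + 1)) = M.tExt (σ j)))
      (fun σ τ h => by beta_reduce; rw [h j (by simp), h (j + 1) (by simp)])
      fun k _ => measurable_history k
  exact measurableSet_setOfPred.2 (hmem.and (Measurable.forall hpath))

theorem ae_compatible (hpt : ∀ j, pt j ∈ M.part j) (n : ℕ) :
    ∀ᵐ z ∂M.chain pt n, M.Compatible z := by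
  induction n with
  | zero => exact (ae_dirac_iff measurableSet_compatible).2 ⟨hpt _, pastPath_infty⟩
  | succ n ih =>
    refine ae_step measurableSet_compatible ?_
    filter_upwards [ih] with z hz e he
    refine ⟨?_, hz.2.snoc (eq_of_mem_part he hz.1)⟩
    simpa using M.w_mapsTo e he

end Chain

/-! ### Contraction of the coding error -/

section Contraction

variable {pt : N → K}

variable (M) in
/-- The largest mean distance, over all times, between the position of the chain and its
reconstruction `X n` from the last `n + 1` edges. -/
def codingError (pt : N → K) (n : ℕ) : ℝ≥0∞ :=
  ⨆ k, ∫⁻ z, edist z.1 (M.X pt n z.2) ∂M.chain pt k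

theorem lintegral_edist_le_codingError (n k : ℕ) :
    ∫⁻ z, edist z.1 (M.X pt n z.2) ∂M.chain pt k ≤ M.codingError pt n :=
  le_iSup (fun k => ∫⁻ z, edist z.1 (M.X pt n z.2) ∂M.chain pt k) k

variable [Countable E]

theorem lintegral_edist_X_zero_chain_le_b (k : ℕ) :
    ∫⁻ z, edist (M.X pt 0 z.2) (pt (M.tExt (z.2 0))) ∂M.chain pt k ≤ M.b pt := by
  have hmeas : Measurable fun z : K × CodeSpace E =>
      edist (M.X pt 0 z.2) (pt (M.tExt (z.2 0))) :=
    measurable_comp_of_dependsOn (I := {0})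
      (f := fun σ => edist (M.X pt 0 σ) (pt (M.tExt (σ 0))))
      (fun σ τ h => by
        beta_reduce
        rw [dependsOn_X 0 (by simpa using h), h 0 (by simp)])
      fun j _ => measurable_history j
  cases k with
  | zero =>
    rw [chain, lintegral_dirac' _ hmeas, X_infty]
    exact (edist_self (pt M.base)).trans_le zero_le
  | succ k =>
    rw [chain, lintegral_step hmeas]
    simp only [X_zero_snoc, snoc_zero, tExt_coe]
    exact (lintegral_mono fun z => tsum_edist_le_b pt).trans (by simp)

variable [BorelSpace K] {a : ℝ≥0∞}

theorem measurable_edist_window {G : CodeSpace E → K} {I : Finset ℤ} (hG : DependsOn G I) :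
    Measurable fun z : K × CodeSpace E => edist z.1 (G z.2) :=
  measurable_uncurry_of_dependsOn (f := fun x σ => edist x (G σ)) (fun _ => measurable_edist_left)
    fun x σ τ h => by beta_reduce; rw [hG h]

/-- `G` and `G'` predict the position from the edge history; `G'` does so by moving the prediction
of `G` along the new edge. -/
theorem lintegral_edist_chain_succ_le (hpt : ∀ j, pt j ∈ M.part j)
    (ha : ∀ j, ∀ x ∈ M.part j, ∀ y ∈ M.part j,
      ∑' e, ENNReal.ofReal (M.p e x) * edist (M.w e x) (M.w e y) ≤ a * edist x y)
    {G G' : CodeSpace E → K} {I I' : Finset ℤ} (hG : DependsOn G I) (hG' : DependsOn G' I')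
    (hmem : ∀ σ, M.PastPath σ → G σ ∈ M.part (M.tExt (σ 0)))
    (hsnoc : ∀ σ e, M.i e = M.tExt (σ 0) → G' (snoc σ e) = M.w e (G σ)) (k : ℕ) :
    ∫⁻ z, edist z.1 (G' z.2) ∂M.chain pt (k + 1) ≤
      a * ∫⁻ z, edist z.1 (G z.2) ∂M.chain pt k := by
  rw [chain, lintegral_step (measurable_edist_window hG'),
    ← lintegral_const_mul _ (measurable_edist_window hG)]
  refine lintegral_mono_ae ?_
  filter_upwards [ae_compatible hpt k] with z hz
  refine (tsum_ofReal_p_mul_le fun e he => ?_).trans (ha _ _ hz.1 _ (hmem _ hz.2))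
  rw [hsnoc _ _ (eq_of_mem_part he hz.1)]

theorem lintegral_edist_pt_chain_le (hpt : ∀ j, pt j ∈ M.part j)
    (ha : ∀ j, ∀ x ∈ M.part j, ∀ y ∈ M.part j,
      ∑' e, ENNReal.ofReal (M.p e x) * edist (M.w e x) (M.w e y) ≤ a * edist x y)
    {C : ℝ≥0∞} (hC : a * C + M.b pt ≤ C) (k : ℕ) :
    ∫⁻ z, edist z.1 (pt (M.tExt (z.2 0))) ∂M.chain pt k ≤ C := by
  induction k with
  | zero =>
    rw [chain, lintegral_dirac' _ (measurable_edist_window dependsOn_pt_tExt)]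
    exact (edist_self (pt M.base)).trans_le zero_le
  | succ k ih =>
    calc ∫⁻ z, edist z.1 (pt (M.tExt (z.2 0))) ∂M.chain pt (k + 1)
        ≤ ∫⁻ z, edist z.1 (M.X pt 0 z.2) + edist (M.X pt 0 z.2) (pt (M.tExt (z.2 0)))
            ∂M.chain pt (k + 1) := lintegral_mono fun z => edist_triangle _ _ _
      _ = ∫⁻ z, edist z.1 (M.X pt 0 z.2) ∂M.chain pt (k + 1) +
            ∫⁻ z, edist (M.X pt 0 z.2) (pt (M.tExt (z.2 0))) ∂M.chain pt (k + 1) :=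
          lintegral_add_left (measurable_edist_window (dependsOn_X 0)) _
      _ ≤ a * ∫⁻ z, edist z.1 (pt (M.tExt (z.2 0))) ∂M.chain pt k + M.b pt :=
          add_le_add
            (lintegral_edist_chain_succ_le hpt ha dependsOn_pt_tExt (dependsOn_X 0)
              (fun _ _ => hpt _) (fun σ e he => by rw [X_zero_snoc, he]) k)
            (lintegral_edist_X_zero_chain_le_b _)
      _ ≤ a * C + M.b pt := by gcongr
      _ ≤ C := hC

theorem lintegral_edist_X_chain_le (hpt : ∀ j, pt j ∈ M.part j)
    (ha : ∀ j, ∀ x ∈ M.part j, ∀ y ∈ M.part j,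
      ∑' e, ENNReal.ofReal (M.p e x) * edist (M.w e x) (M.w e y) ≤ a * edist x y)
    {C : ℝ≥0∞} (hC : ∀ k, ∫⁻ z, edist z.1 (pt (M.tExt (z.2 0))) ∂M.chain pt k ≤ C) (n k : ℕ) :
    ∫⁻ z, edist z.1 (M.X pt n z.2) ∂M.chain pt k ≤ a ^ (n + 1) * C := by
  induction k generalizing n with
  | zero =>
    rw [chain, lintegral_dirac' _ (measurable_edist_window (dependsOn_X n)), X_infty, edist_self]
    exact zero_le
  | succ k ih =>
    cases n with
    | zero =>
      rw [zero_add, pow_one]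
      exact (lintegral_edist_chain_succ_le hpt ha dependsOn_pt_tExt (dependsOn_X 0)
        (fun _ _ => hpt _) (fun σ e he => by rw [X_zero_snoc, he]) k).trans (by gcongr; exact hC k)
    | succ n =>
      rw [pow_succ', mul_assoc]
      exact (lintegral_edist_chain_succ_le hpt ha (dependsOn_X n) (dependsOn_X (n + 1))
        (fun σ hσ => hσ.X_mem hpt n) (fun σ e _ => X_succ_snoc σ e n) k).trans
        (by gcongr; exact ih n)

theorem tsum_codingError_ne_top (hpt : ∀ j, pt j ∈ M.part j) (hcontr : M.Contractive)
    (hb : M.b pt < ∞) : ∑' n, M.codingError pt n ≠ ∞ := by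
  obtain ⟨a, ha1, ha⟩ := hcontr.exists_tsum_edist_le
  have hgeom : ∑' n : ℕ, a ^ n ≠ ∞ := by
    rw [ENNReal.tsum_geometric]
    exact ENNReal.inv_ne_top.2 (tsub_pos_of_lt ha1).ne'
  -- `C = b / (1 - a)` is the fixed point of `C ↦ a * C + b`.
  set C := (∑' n : ℕ, a ^ n) * M.b pt with hCdef
  have hC : a * C + M.b pt ≤ C := by
    conv_rhs => rw [hCdef, tsum_eq_zero_add' ENNReal.summable]
    simp only [pow_zero, pow_succ', ENNReal.tsum_mul_left, hCdef]
    exact le_of_eq (by ring)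
  refine ne_top_of_le_ne_top
    (ENNReal.mul_ne_top hgeom (ENNReal.mul_ne_top hgeom hb.ne)) ?_
  rw [← ENNReal.tsum_mul_right]
  refine ENNReal.tsum_le_tsum fun n => iSup_le fun k => ?_
  calc ∫⁻ z, edist z.1 (M.X pt n z.2) ∂M.chain pt k ≤ a ^ (n + 1) * C :=
        lintegral_edist_X_chain_le hpt ha (lintegral_edist_pt_chain_le hpt ha hC) n k
    _ ≤ a ^ n * C := mul_le_mul_left (pow_le_pow_right_of_le_one' ha1.le n.le_succ) _

end Contraction

/-! ### Tightness of the edge process -/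

section Tightness

theorem tsum_supProb_le_xi (j k : N) :
    ∑' e : {e : E // M.i e = j ∧ M.t e = k}, M.supProb e.1 ≤ M.xi j :=
  ENNReal.tsum_mono_subtype M.supProb (s := {e | M.i e = j ∧ M.t e = k}) (t := {e | M.i e = j})
    fun _ h => h.1

theorem xi_mul_q (hdom : M.HasDominatingChain) (j k : N) :
    M.xi j * M.q j k = ∑' e : {e : E // M.i e = j ∧ M.t e = k}, M.supProb e.1 := by
  rcases eq_or_ne (M.xi j) 0 with h | h
  · rw [h, zero_mul]
    exact (le_antisymm ((tsum_supProb_le_xi j k).trans h.le) zero_le).symm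
  · rw [q, ← mul_assoc, ENNReal.mul_inv_cancel h (hdom j).ne, one_mul]

theorem c_lt_top_of_finite [Finite N] (hdom : M.HasDominatingChain) : M.c < ∞ := by
  have := Fintype.ofFinite N
  have hle : ∀ k, ⨆ j, M.xi j * M.q j k ≤ ∑ j, M.xi j := fun k => iSup_le fun j => by
    rw [xi_mul_q hdom]
    exact (tsum_supProb_le_xi j k).trans (Finset.single_le_sum_of_canonicallyOrdered
      (Finset.mem_univ j))
  rw [c, tsum_fintype]
  exact ENNReal.sum_lt_top.2 fun k _ => (hle k).trans_lt (ENNReal.sum_lt_top.2 fun j _ => hdom j)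

theorem tsum_ofReal_p_mul_indicator_part_le (hdom : M.HasDominatingChain) (x : K) (k : N) :
    ∑' e, ENNReal.ofReal (M.p e x) * (M.part k).indicator 1 (M.w e x) ≤
      ⨆ j, M.xi j * M.q j k := by
  obtain ⟨j, hj⟩ := M.exists_mem_part x
  refine le_iSup_of_le j ?_
  rw [xi_mul_q hdom]
  refine le_trans (ENNReal.tsum_le_tsum fun e => ?_)
    (tsum_subtype {e : E | M.i e = j ∧ M.t e = k} M.supProb).symm.le
  by_cases he : x ∈ M.part (M.i e)
  · by_cases ht : M.t e = k
    · have hmem : e ∈ {e : E | M.i e = j ∧ M.t e = k} := ⟨eq_of_mem_part he hj, ht⟩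
      rw [indicator_of_mem hmem]
      refine (mul_le_of_le_one_right' ?_).trans (ofReal_p_le_supProb he)
      exact indicator_le_self' (by simp) _
    · have hw : M.w e x ∉ M.part k := fun h => ht (eq_of_mem_part (M.w_mapsTo e he) h)
      simp [hw]
  · simp [M.p_eq_zero e _ he]

theorem exists_finset_edges_forall_tsum_le (hdom : M.HasDominatingChain) (V : Finset N)
    {ε : ℝ≥0∞} (hε : 0 < ε) :
    ∃ S : Finset E, ∀ j ∈ V, ∀ x ∈ M.part j,
      ∑' e, ENNReal.ofReal (M.p e x) * {e | e ∉ S}.indicator 1 e ≤ ε := by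
  have htail : ∀ᶠ S : Finset E in atTop, ∀ j ∈ V,
      ∑' e : {e // e ∉ S}, {e | M.i e = j}.indicator M.supProb e ≤ ε := by
    refine V.eventually_all.2 fun j _ => ?_
    have hsum : ∑' e, {e | M.i e = j}.indicator M.supProb e ≠ ∞ := by
      rw [← tsum_subtype]
      exact (hdom j).ne
    exact (ENNReal.tendsto_tsum_compl_atTop_zero hsum).eventually (ge_mem_nhds hε)
  obtain ⟨S, hS⟩ := htail.exists
  refine ⟨S, fun j hj x hx => le_trans (le_trans (ENNReal.tsum_le_tsum fun e => ?_)
    (tsum_subtype {e | e ∉ S} _).symm.le) (hS j hj)⟩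
  by_cases he : x ∈ M.part (M.i e)
  · by_cases heS : e ∈ S
    · simp [heS]
    · simpa [heS, eq_of_mem_part he hx] using ofReal_p_le_supProb he
  · simp [M.p_eq_zero e _ he]

variable [Countable E] {pt : N → K} {ε : ℝ≥0∞}

theorem chain_succ_part_le (hdom : M.HasDominatingChain) (n : ℕ) (k : N) :
    M.chain pt (n + 1) {z | z.1 ∈ M.part k} ≤ ⨆ j, M.xi j * M.q j k := by
  have hm : MeasurableSet {z : K × CodeSpace E | z.1 ∈ M.part k} :=
    measurable_fst (M.part_measurable k)
  calc M.chain pt (n + 1) {z | z.1 ∈ M.part k}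
      = ∫⁻ z, ∑' e, ENNReal.ofReal (M.p e z.1) * (M.part k).indicator 1 (M.w e z.1)
          ∂M.chain pt n := step_apply hm
    _ ≤ ∫⁻ _, ⨆ j, M.xi j * M.q j k ∂M.chain pt n :=
        lintegral_mono fun z => tsum_ofReal_p_mul_indicator_part_le hdom z.1 k
    _ = ⨆ j, M.xi j * M.q j k := by simp

theorem exists_finset_vertices_forall_chain_le (hpt : ∀ j, pt j ∈ M.part j)
    (hdom : M.HasDominatingChain) (hc : M.c < ∞) (hε : 0 < ε) :
    ∃ V : Finset N, ∀ n, M.chain pt n {z | ∀ j ∈ V, z.1 ∉ M.part j} ≤ ε := by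
  classical
  have : Countable N := M.i_surjective.countable
  obtain ⟨V, hV⟩ := ((ENNReal.tendsto_tsum_compl_atTop_zero hc.ne).eventually
    (ge_mem_nhds hε)).exists
  refine ⟨insert M.base V, fun n => ?_⟩
  cases n with
  | zero =>
    have hbase : ∀ᵐ z ∂M.chain pt 0, z.1 ∈ M.part M.base :=
      (ae_dirac_iff (measurable_fst (M.part_measurable _))).2 (hpt _)
    refine le_trans (le_of_eq (measure_mono_null (fun z hz => ?_) hbase)) zero_le
    exact hz _ (Finset.mem_insert_self _ _)
  | succ n =>
    calc M.chain pt (n + 1) {z | ∀ j ∈ insert M.base V, z.1 ∉ M.part j}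
        ≤ M.chain pt (n + 1) (⋃ k : {k // k ∉ V}, {z | z.1 ∈ M.part k}) := by
          refine measure_mono fun z hz => ?_
          obtain ⟨k, hk⟩ := M.exists_mem_part z.1
          exact mem_iUnion.2 ⟨⟨k, fun h => hz k (Finset.mem_insert_of_mem h) hk⟩, hk⟩
      _ ≤ ∑' k : {k // k ∉ V}, M.chain pt (n + 1) {z | z.1 ∈ M.part k} := measure_iUnion_le _
      _ ≤ ∑' k : {k // k ∉ V}, ⨆ j, M.xi j * M.q j k :=
          ENNReal.tsum_le_tsum fun k => chain_succ_part_le hdom n k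
      _ ≤ ε := hV

theorem chain_succ_edge_notMem_le {V : Finset N} {S : Finset E} {δ : ℝ≥0∞}
    (hS : ∀ j ∈ V, ∀ x ∈ M.part j,
      ∑' e, ENNReal.ofReal (M.p e x) * {e | e ∉ S}.indicator 1 e ≤ ε) (n : ℕ)
    (hV : M.chain pt n {z | ∀ j ∈ V, z.1 ∉ M.part j} ≤ δ) :
    M.chain pt (n + 1) {z | ∀ e ∈ S, z.2 0 ≠ (e : OnePoint E)} ≤ δ + ε := by
  classical
  set A : Set (K × CodeSpace E) := {z | ∀ j ∈ V, z.1 ∉ M.part j} with hA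
  have hAm : MeasurableSet A := by
    have : Countable N := M.i_surjective.countable
    simp only [hA, Set.ofPred_forall]
    exact .iInter fun j => .iInter fun _ => (measurable_fst (M.part_measurable j)).compl
  have hm : MeasurableSet {z : K × CodeSpace E | ∀ e ∈ S, z.2 0 ≠ (e : OnePoint E)} :=
    measurable_history 0 (.of_discrete (s := {b | ∀ e ∈ S, b ≠ (e : OnePoint E)}))
  calc M.chain pt (n + 1) {z | ∀ e ∈ S, z.2 0 ≠ (e : OnePoint E)}
      = ∫⁻ z, ∑' e, ENNReal.ofReal (M.p e z.1) * {e | e ∉ S}.indicator 1 e ∂M.chain pt n := by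
        rw [chain, step_apply hm]
        simp [indicator_apply]
    _ ≤ ∫⁻ z, A.indicator 1 z + ε ∂M.chain pt n := by
        refine lintegral_mono fun z => ?_
        by_cases hz : z ∈ A
        · rw [indicator_of_mem hz, Pi.one_apply]
          refine le_add_right ((ENNReal.tsum_le_tsum fun e => ?_).trans (M.tsum_ofReal_p z.1).le)
          exact mul_le_of_le_one_right' (indicator_le_self' (by simp) _)
        · obtain ⟨j, hj, hzj⟩ : ∃ j ∈ V, z.1 ∈ M.part j := by simpa [hA] using hz
          exact le_add_left (hS j hj z.1 hzj)
    _ = M.chain pt n A + ε := by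
        rw [lintegral_add_right _ measurable_const, lintegral_indicator_one hAm]
        simp
    _ ≤ δ + ε := by gcongr

theorem exists_finset_forall_chain_zero_notMem_le (hpt : ∀ j, pt j ∈ M.part j)
    (hdom : M.HasDominatingChain) (hc : M.c < ∞) (hε : 0 < ε) :
    ∃ S : Finset (OnePoint E), OnePoint.infty ∈ S ∧ ∀ n, M.chain pt n {z | z.2 0 ∉ S} ≤ ε := by
  classical
  have hε2 : 0 < ε / 2 := ENNReal.half_pos hε.ne'
  obtain ⟨V, hV⟩ := exists_finset_vertices_forall_chain_le hpt hdom hc hε2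
  obtain ⟨S, hS⟩ := exists_finset_edges_forall_tsum_le hdom V hε2
  set S' : Finset (OnePoint E) := insert OnePoint.infty (S.image (↑)) with hS'
  refine ⟨S', Finset.mem_insert_self _ _, fun n => ?_⟩
  cases n with
  | zero =>
    have hm : MeasurableSet {z : K × CodeSpace E | z.2 0 ∉ S'} :=
      measurable_history 0 (.of_discrete (s := {b | b ∉ S'}))
    rw [chain, Measure.dirac_apply' _ hm]
    simp [hS']
  | succ n =>
    calc M.chain pt (n + 1) {z | z.2 0 ∉ S'}
        ≤ M.chain pt (n + 1) {z | ∀ e ∈ S, z.2 0 ≠ (e : OnePoint E)} :=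
          measure_mono fun z hz e he h => hz (by simp [hS', h, he])
      _ ≤ ε / 2 + ε / 2 := chain_succ_edge_notMem_le hS n (hV n)
      _ = ε := ENNReal.add_halves ε

theorem chain_notMem_le {S : Set (OnePoint E)} (hinfty : OnePoint.infty ∈ S)
    (hS : ∀ n, M.chain pt n {z | z.2 0 ∉ S} ≤ ε) (n : ℕ) (j : ℤ) :
    M.chain pt n {z | z.2 j ∉ S} ≤ ε := by
  have hm : ∀ j : ℤ, MeasurableSet {z : K × CodeSpace E | z.2 j ∉ S} := fun j =>
    measurable_history j (.of_discrete (s := {b | b ∉ S}))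
  induction n generalizing j with
  | zero =>
    rw [chain, Measure.dirac_apply' _ (hm j), indicator_of_notMem (by simpa)]
    exact zero_le
  | succ n ih =>
    rcases eq_or_ne j 0 with rfl | hj
    · exact hS (n + 1)
    · refine le_of_eq_of_le ?_ (ih (j + 1))
      rw [chain, step_apply (hm j), ← lintegral_indicator_one (hm (j + 1))]
      refine lintegral_congr fun z => ?_
      have hind : ∀ e : E, {z | z.2 j ∉ S}.indicator (1 : K × CodeSpace E → ℝ≥0∞)
          (M.w e z.1, snoc z.2 e) = {z | z.2 (j + 1) ∉ S}.indicator 1 z := fun e => by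
        classical
        simp [indicator_apply, snoc_of_ne _ _ hj]
      simp only [hind, ENNReal.tsum_mul_right, tsum_ofReal_p, one_mul]

end Tightness

/-! ### Averaged laws of the edge sequence -/

section Laws

variable (M) in
/-- The law of the edge sequence seen from time `k`, with `s` edges of the future recorded. -/
def law (pt : N → K) (k s : ℕ) : Measure (CodeSpace E) :=
  (M.chain pt (k + s)).map fun z => delay s z.2

variable (M) in
/-- Time averages of the laws of the edge sequence. The `n`-th average records `n` edges of the
past and `n` of the future, so that every window is eventually covered. -/
def averagedLaw (pt : N → K) (n : ℕ) : Measure (CodeSpace E) :=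
  ((n : ℝ≥0∞) + 1)⁻¹ • ∑ k ∈ Finset.range (n + 1), M.law pt (k + n) n

variable {pt : N → K} {f : CodeSpace E → ℝ≥0∞}

theorem lintegral_law (hf : Measurable f) (k s : ℕ) :
    ∫⁻ σ, f σ ∂M.law pt k s = ∫⁻ z, f (delay s z.2) ∂M.chain pt (k + s) :=
  lintegral_map hf (measurable_delay_history s)

theorem lintegral_law_shift (hf : Measurable f) (k s : ℕ) :
    ∫⁻ σ, f (shift σ) ∂M.law pt k (s + 1) = ∫⁻ σ, f σ ∂M.law pt (k + 1) s := by
  refine (lintegral_law (hf.comp measurable_shift) _ _).trans ?_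
  rw [lintegral_law hf, show k + 1 + s = k + (s + 1) by ring]
  simp only [Function.comp_apply, shift_delay_succ]

theorem lintegral_averagedLaw (n : ℕ) (f : CodeSpace E → ℝ≥0∞) :
    ∫⁻ σ, f σ ∂M.averagedLaw pt n =
      ((n : ℝ≥0∞) + 1)⁻¹ * ∑ k ∈ Finset.range (n + 1), ∫⁻ σ, f σ ∂M.law pt (k + n) n := by
  rw [averagedLaw, lintegral_smul_measure, lintegral_finsetSum_measure, smul_eq_mul]

theorem lintegral_averagedLaw_le_add {n : ℕ} {f g : CodeSpace E → ℝ≥0∞} {C : ℝ≥0∞}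
    (h : ∀ k, ∫⁻ σ, f σ ∂M.law pt (k + n) n ≤ ∫⁻ σ, g σ ∂M.law pt (k + n) n + C) :
    ∫⁻ σ, f σ ∂M.averagedLaw pt n ≤ ∫⁻ σ, g σ ∂M.averagedLaw pt n + C := by
  rw [lintegral_averagedLaw, lintegral_averagedLaw]
  calc ((n : ℝ≥0∞) + 1)⁻¹ * ∑ k ∈ Finset.range (n + 1), ∫⁻ σ, f σ ∂M.law pt (k + n) n
      ≤ ((n : ℝ≥0∞) + 1)⁻¹ *
          ∑ k ∈ Finset.range (n + 1), (∫⁻ σ, g σ ∂M.law pt (k + n) n + C) := by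
        gcongr with k
        exact h k
    _ = ((n : ℝ≥0∞) + 1)⁻¹ * ∑ k ∈ Finset.range (n + 1), ∫⁻ σ, g σ ∂M.law pt (k + n) n + C := by
        rw [Finset.sum_add_distrib, mul_add, Finset.sum_const, Finset.card_range, nsmul_eq_mul,
          Nat.cast_succ, ENNReal.inv_mul_cancel_left (by simp) (by finiteness)]

variable [Countable E]

instance isProbabilityMeasure_law (k s : ℕ) : IsProbabilityMeasure (M.law pt k s) :=
  Measure.isProbabilityMeasure_map (measurable_delay_history s).aemeasurable

theorem lintegral_law_succ (hf : Measurable f) (k s : ℕ) :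
    ∫⁻ σ, f σ ∂M.law pt k (s + 1) =
      ∫⁻ z, ∑' e, ENNReal.ofReal (M.p e z.1) * f (delay (s + 1) (snoc z.2 e))
        ∂M.chain pt (k + s) := by
  rw [lintegral_law hf, ← add_assoc, chain]
  exact lintegral_step (hf.comp (measurable_delay_history (s + 1)))

theorem lintegral_law_succ_of_dependsOn (hf : Measurable f) {k s : ℕ}
    (hd : DependsOn f (Iic (s : ℤ))) :
    ∫⁻ σ, f σ ∂M.law pt k (s + 1) = ∫⁻ σ, f σ ∂M.law pt k s := by
  rw [lintegral_law_succ hf, lintegral_law hf]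
  refine lintegral_congr fun z => ?_
  have hdelay : ∀ e : E, f (delay (s + 1) (snoc z.2 e)) = f (delay s z.2) := fun e =>
    hd fun j hj => delay_succ_snoc_of_le hj _ _
  simp only [hdelay, ENNReal.tsum_mul_right, tsum_ofReal_p, one_mul]

theorem lintegral_law_of_le (hf : Measurable f) {k s s' : ℕ} (hs : s ≤ s')
    (hd : DependsOn f (Iic (s : ℤ))) :
    ∫⁻ σ, f σ ∂M.law pt k s' = ∫⁻ σ, f σ ∂M.law pt k s := by
  induction s', hs using Nat.le_induction with
  | base => rfl
  | succ m hm ih =>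
    rw [← ih, lintegral_law_succ_of_dependsOn hf
      (hd.mono (Iic_subset_Iic.2 (by exact_mod_cast hm)))]

theorem lintegral_averagedLaw_le_of_forall {n : ℕ} {C : ℝ≥0∞}
    (h : ∀ k, ∫⁻ σ, f σ ∂M.law pt (k + n) n ≤ C) : ∫⁻ σ, f σ ∂M.averagedLaw pt n ≤ C := by
  simpa using lintegral_averagedLaw_le_add (g := 0) (C := C) (by simpa using h)

instance isProbabilityMeasure_averagedLaw (n : ℕ) : IsProbabilityMeasure (M.averagedLaw pt n) := by
  constructor
  rw [← lintegral_one, lintegral_averagedLaw]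
  simp only [lintegral_one, measure_univ, Finset.sum_const, Finset.card_range, nsmul_eq_mul,
    Nat.cast_succ, mul_one]
  exact ENNReal.inv_mul_cancel (by simp) (by finiteness)

theorem lintegral_law_of_past {I : Finset ℤ} (hf : DependsOn f I) (hI : (I : Set ℤ) ⊆ Iic 0)
    (k s : ℕ) : ∫⁻ σ, f σ ∂M.law pt k s = ∫⁻ z, f z.2 ∂M.chain pt k := by
  have hfm := measurable_of_dependsOn hf
  rw [lintegral_law_of_le hfm s.zero_le (hf.mono (by simpa using hI)), lintegral_law hfm]
  simp only [delay_zero, add_zero]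

theorem averagedLaw_le_of_forall {n : ℕ} {A : Set (CodeSpace E)} (hA : MeasurableSet A)
    {C : ℝ≥0∞} (h : ∀ k, M.chain pt (k + n + n) {z | delay n z.2 ∈ A} ≤ C) :
    M.averagedLaw pt n A ≤ C := by
  rw [← lintegral_indicator_one hA]
  refine lintegral_averagedLaw_le_of_forall fun k => ?_
  rw [lintegral_indicator_one hA, law, Measure.map_apply (measurable_delay_history n) hA]
  exact h _

/-- The averages of `f` and `f ∘ shift` differ only in their first and last terms. -/
theorem lintegral_averagedLaw_shift_le (hf : Measurable f) (hf1 : ∀ σ, f σ ≤ 1) {n : ℕ}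
    (hn : n ≠ 0) (hd : DependsOn f (Iio (n : ℤ))) :
    ∫⁻ σ, f (shift σ) ∂M.averagedLaw pt n ≤
      ∫⁻ σ, f σ ∂M.averagedLaw pt n + ((n : ℝ≥0∞) + 1)⁻¹ := by
  obtain ⟨s, rfl⟩ := Nat.exists_eq_succ_of_ne_zero hn
  have hshift : ∀ k, ∫⁻ σ, f (shift σ) ∂M.law pt (k + (s + 1)) (s + 1) =
      ∫⁻ σ, f σ ∂M.law pt (k + 1 + (s + 1)) (s + 1) := fun k => by
    rw [lintegral_law_shift hf, ← lintegral_law_succ_of_dependsOn hf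
      (hd.mono fun j hj => by simpa [Int.lt_add_one_iff] using hj),
      show k + (s + 1) + 1 = k + 1 + (s + 1) by ring]
  have hlast : ∀ k, ∫⁻ σ, f σ ∂M.law pt k (s + 1) ≤ 1 := fun k =>
    (lintegral_mono hf1).trans (by simp)
  rw [lintegral_averagedLaw, lintegral_averagedLaw, Nat.succ_eq_add_one]
  simp only [hshift]
  rw [Finset.sum_range_succ]
  conv_rhs => rw [Finset.sum_range_succ']
  rw [mul_add, mul_add]
  exact add_le_add le_self_add (mul_le_of_le_one_right' (hlast _))

end Laws

/-! ### Limits of the averaged laws -/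

section EdgeLimit

variable (M) in
/-- A limit along a filter of times of the averaged laws of the edge sequence; these limits are
the asymptotic states from which an invariant measure is read off. -/
structure IsEdgeLimit (pt : N → K) (L : Filter ℕ) (Λ : Measure (CodeSpace E)) : Prop where
  le_atTop : L ≤ atTop
  tendstoOnWindows : TendstoOnWindows (M.averagedLaw pt) L Λ

variable {pt : N → K} {L : Filter ℕ} {Λ : Measure (CodeSpace E)}

theorem IsEdgeLimit.lintegral_le_lintegral_add [L.NeBot] (h : M.IsEdgeLimit pt L Λ)
    {f g : CodeSpace E → ℝ≥0∞} {I J : Finset ℤ} (hf : DependsOn f I) (hg : DependsOn g J)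
    (hf1 : ∀ σ, f σ ≤ 1) (hg1 : ∀ σ, g σ ≤ 1) {C : ℝ≥0∞}
    (hle : ∀ k s, s ≠ 0 → ∫⁻ σ, f σ ∂M.law pt k s ≤ ∫⁻ σ, g σ ∂M.law pt k s + C) :
    ∫⁻ σ, f σ ∂Λ ≤ ∫⁻ σ, g σ ∂Λ + C := by
  refine le_of_tendsto_of_tendsto (h.tendstoOnWindows f I 1 hf (by simpa using hf1))
    ((h.tendstoOnWindows g J 1 hg (by simpa using hg1)).add_const C) ?_
  filter_upwards [h.le_atTop (eventually_ne_atTop 0)] with n hn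
  exact lintegral_averagedLaw_le_add fun k => hle _ n hn

variable [Countable E]

theorem exists_isEdgeLimit (hpt : ∀ j, pt j ∈ M.part j) (hdom : M.HasDominatingChain)
    (hc : M.c < ∞) : ∃ L Λ, L.NeBot ∧ IsProbabilityMeasure Λ ∧ M.IsEdgeLimit pt L Λ := by
  obtain ⟨Λ, hΛ, hlim⟩ := exists_tendstoOnWindows (μ := M.averagedLaw pt) (fun j ε hε => by
    obtain ⟨S, hinfty, hS⟩ := exists_finset_forall_chain_zero_notMem_le hpt hdom hc hε
    exact ⟨S, fun n => averagedLaw_le_of_forall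
      (measurable_pi_apply j (.of_discrete (s := {b | b ∉ S})))
      fun k => chain_notMem_le (S := (S : Set (OnePoint E))) hinfty hS _ (j - n)⟩) (hyperfilter ℕ)
  exact ⟨_, Λ, inferInstance, hΛ, Nat.hyperfilter_le_atTop, hlim⟩

theorem eventually_subset_Iio (I : Finset ℤ) : ∀ᶠ n : ℕ in atTop, (I : Set ℤ) ⊆ Iio (n : ℤ) :=
  I.eventually_all.2 fun j _ => tendsto_natCast_atTop_atTop.eventually_gt_atTop j

namespace IsEdgeLimit

variable [L.NeBot]

theorem ae_mem_pathSpace (h : M.IsEdgeLimit pt L Λ) (hpt : ∀ j, pt j ∈ M.part j) :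
    ∀ᵐ σ ∂Λ, σ ∈ M.pathSpace := by
  refine ae_all_iff.2 fun m => ?_
  set P : CodeSpace E → Prop := fun σ =>
    (∃ e : E, σ m = (e : OnePoint E)) ∧ M.iExt (σ (m + 1)) = M.tExt (σ m)
  have hP : DependsOn P (({m, m + 1} : Finset ℤ) : Set ℤ) := fun σ τ hστ => by
    simp only [P]
    rw [hστ m (by simp), hστ (m + 1) (by simp)]
  refine h.tendstoOnWindows.ae_of_eventually_ae hP ?_
  filter_upwards [h.le_atTop (eventually_gt_atTop m.natAbs)] with n hn
  refine le_antisymm (averagedLaw_le_of_forall (measurableSet_of_dependsOn hP).compl fun k => ?_)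
    zero_le
  refine le_of_eq ?_
  change ∀ᵐ z ∂M.chain pt (k + n + n), P (delay n z.2)
  filter_upwards [ae_compatible hpt (k + n + n),
    ae_ne_infty (j := m - n) (n := k + n + n) (by omega) (by push_cast; omega)] with z hz hne
  obtain ⟨e, he⟩ := OnePoint.ne_infty_iff_exists.1 hne
  refine ⟨⟨e, he.symm⟩, ?_⟩
  have hpath := hz.2 (m - n) (by omega)
  rwa [sub_add_eq_add_sub] at hpath

theorem measurePreserving_shift [IsProbabilityMeasure Λ] (h : M.IsEdgeLimit pt L Λ) :
    MeasurePreserving shift Λ Λ := by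
  have := Measure.isProbabilityMeasure_map (μ := Λ) measurable_shift.aemeasurable
  refine ⟨measurable_shift, eq_of_forall_measurableCylinders_le fun B hB => ?_⟩
  obtain ⟨I, S, -, rfl⟩ := (mem_measurableCylinders B).1 hB
  have hd : DependsOn (fun σ : CodeSpace E => σ ∈ cylinder I S) (I : Set ℤ) := fun σ τ hστ => by
    simp only [mem_cylinder, show I.restrict σ = I.restrict τ from funext fun i => hστ i i.2]
  have hd' : DependsOn (fun σ : CodeSpace E => σ ∈ shift ⁻¹' cylinder I S)
      (I.image (· + 1) : Finset ℤ) :=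
    fun σ τ hστ => hd fun j hj => hστ (j + 1) (by simpa using hj)
  have hBm := MeasurableSet.of_mem_measurableCylinders hB
  rw [Measure.map_apply measurable_shift hBm]
  have hinv : Tendsto (fun n : ℕ => ((n : ℝ≥0∞) + 1)⁻¹) L (𝓝 0) := by
    simpa [Function.comp_def] using
      (ENNReal.tendsto_inv_nat_nhds_zero.comp (tendsto_add_atTop_nat 1)).mono_left h.le_atTop
  have hlim := (h.tendstoOnWindows.tendsto_measure hd).add hinv
  rw [add_zero] at hlim
  refine le_of_tendsto_of_tendsto (h.tendstoOnWindows.tendsto_measure hd') hlim ?_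
  filter_upwards [h.le_atTop (eventually_subset_Iio I), h.le_atTop (eventually_ne_atTop 0)]
    with n hI hn
  rw [← lintegral_indicator_one hBm, ← lintegral_indicator_one (measurable_shift hBm)]
  exact lintegral_averagedLaw_shift_le (measurable_one.indicator hBm) (indicator_le_self' (by simp))
    hn ((dependsOn_indicator_one hd).mono hI)

variable [BorelSpace K]

theorem lintegral_edist_X_succ_le (h : M.IsEdgeLimit pt L Λ) (m : ℕ) :
    ∫⁻ σ, edist (M.X pt m σ) (M.X pt (m + 1) σ) ∂Λ ≤
      M.codingError pt m + M.codingError pt (m + 1) := by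
  refine h.tendstoOnWindows.lintegral_le_of_eventually_le (dependsOn_edist_X m)
    (.of_forall fun n => lintegral_averagedLaw_le_of_forall fun k => ?_)
  rw [lintegral_law_of_past (dependsOn_edist_X m) (coe_Icc_zero_subset_Iic _)]
  refine (lintegral_mono fun z => edist_triangle_left _ _ z.1).trans ?_
  rw [lintegral_add_left (measurable_edist_window (dependsOn_X m))]
  exact add_le_add (lintegral_edist_le_codingError m _) (lintegral_edist_le_codingError (m + 1) _)

variable [CompleteSpace K]

theorem ae_mem_D (h : M.IsEdgeLimit pt L Λ) (hpt : ∀ j, pt j ∈ M.part j)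
    (hsum : ∑' m, M.codingError pt m ≠ ∞) : ∀ᵐ σ ∂Λ, σ ∈ M.D pt := by
  have hmeas : ∀ m, Measurable fun σ => edist (M.X pt m σ) (M.X pt (m + 1) σ) := fun m =>
    measurable_of_dependsOn (dependsOn_edist_X m)
  have hfin : ∫⁻ σ, ∑' m, edist (M.X pt m σ) (M.X pt (m + 1) σ) ∂Λ ≠ ∞ := by
    rw [lintegral_tsum fun m => (hmeas m).aemeasurable]
    refine ne_top_of_le_ne_top ?_ (ENNReal.tsum_le_tsum h.lintegral_edist_X_succ_le)
    rw [ENNReal.tsum_add]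
    refine ENNReal.add_ne_top.2 ⟨hsum, ne_top_of_le_ne_top hsum ?_⟩
    exact ENNReal.tsum_comp_le_tsum_of_injective Nat.succ_injective _
  filter_upwards [h.ae_mem_pathSpace hpt, ae_lt_top (.tsum hmeas) hfin] with σ hσ hlt
  exact ⟨hσ, cauchySeq_tendsto_of_complete
    (cauchySeq_of_edist_le_of_tsum_ne_top _ (fun _ => le_rfl) hlt.ne)⟩

end IsEdgeLimit

end EdgeLimit

/-! ### The conditional law of the next edge -/

section ConditionalLaw

variable {pt : N → K} {e : E}

theorem tendsto_p_pBar (hp : UniformContinuousOn (M.p e) (M.part (M.i e))) {x : K} {u : ℕ → K}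
    (hu : ∀ n, u n ∈ M.part (M.i e)) (hx : Tendsto u atTop (𝓝 x)) :
    Tendsto (fun n => M.p e (u n)) atTop (𝓝 (M.pBar e x)) := by
  have hcl : x ∈ closure (M.part (M.i e)) := mem_closure_of_tendsto hx (.of_forall hu)
  have : (𝓝[M.part (M.i e)] x).NeBot := mem_closure_iff_nhdsWithin_neBot.1 hcl
  have hcauchy : Cauchy (map (M.p e) (𝓝[M.part (M.i e)] x)) :=
    (cauchy_nhds.mono (nhdsWithin_le_nhds (s := M.part (M.i e)))).map_of_le hp inf_le_right
  rw [pBar, if_pos hcl]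
  exact (tendsto_extendFrom (CompleteSpace.complete hcauchy)).comp
    (tendsto_nhdsWithin_iff.2 ⟨hx, .of_forall hu⟩)

theorem tendsto_X_F {σ : CodeSpace E} (hσ : σ ∈ M.D pt) :
    Tendsto (fun n => M.X pt n σ) atTop (𝓝 (M.F pt σ)) := by
  rw [F, dif_pos hσ]
  exact hσ.2.choose_spec

theorem tendsto_p_X (hpt : ∀ j, pt j ∈ M.part j)
    (hp : UniformContinuousOn (M.p e) (M.part (M.i e))) {σ : CodeSpace E} (hσ : σ ∈ M.D pt) :
    Tendsto (fun n => M.p e (M.X pt n σ)) atTop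
      (𝓝 ((M.T (M.i e)).indicator (fun σ => M.pBar e (M.F pt σ)) σ)) := by
  have hmem : ∀ n, M.X pt n σ ∈ M.part (M.tExt (σ 0)) := fun n =>
    PastPath.X_mem (fun j _ => (hσ.1 j).2) hpt n
  by_cases ht : M.tExt (σ 0) = M.i e
  · rw [indicator_of_mem (show σ ∈ M.T (M.i e) from ⟨hσ.1, ht⟩)]
    exact tendsto_p_pBar hp (fun n => ht ▸ hmem n) (tendsto_X_F hσ)
  · rw [indicator_of_notMem fun h => ht h.2]
    have hzero : ∀ n, M.p e (M.X pt n σ) = 0 := fun n =>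
      M.p_eq_zero e _ fun h => ht (eq_of_mem_part (hmem n) h)
    simp only [hzero, tendsto_const_nhds]

theorem exists_ofReal_p_le_add (hp : UniformContinuousOn (M.p e) (M.part (M.i e))) {ε : ℝ≥0}
    (hε : 0 < ε) :
    ∃ B : ℝ≥0∞, B ≠ ∞ ∧ ∀ j, ∀ x ∈ M.part j, ∀ y ∈ M.part j,
      ENNReal.ofReal (M.p e x) ≤ ENNReal.ofReal (M.p e y) + (ε + B * edist x y) := by
  obtain ⟨δ, hδ, h⟩ := Metric.uniformContinuousOn_iff.1 hp ε hε
  refine ⟨(ENNReal.ofReal δ)⁻¹, by simpa using hδ, fun j x hx y hy => ?_⟩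
  rcases ne_or_eq j (M.i e) with hj | rfl
  · simp [M.p_eq_zero e x fun h' => hj (eq_of_mem_part hx h')]
  rcases lt_or_ge (dist x y) δ with hclose | hfar
  · have hlt := (abs_lt.1 (h x hx y hy hclose)).2
    calc ENNReal.ofReal (M.p e x) ≤ ENNReal.ofReal (M.p e y + ε) :=
          ENNReal.ofReal_le_ofReal (by linarith)
      _ = ENNReal.ofReal (M.p e y) + ε := by
          rw [ENNReal.ofReal_add (M.p_nonneg _ _) ε.coe_nonneg, ENNReal.ofReal_coe_nnreal]
      _ ≤ ENNReal.ofReal (M.p e y) + (ε + (ENNReal.ofReal δ)⁻¹ * edist x y) := by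
          gcongr
          exact le_self_add
  · calc ENNReal.ofReal (M.p e x) ≤ 1 := by simpa using M.p_le_one e x
      _ = (ENNReal.ofReal δ)⁻¹ * ENNReal.ofReal δ :=
          (ENNReal.inv_mul_cancel (by simpa using hδ) ENNReal.ofReal_ne_top).symm
      _ ≤ (ENNReal.ofReal δ)⁻¹ * edist x y := by
          rw [edist_dist]
          gcongr
      _ ≤ ENNReal.ofReal (M.p e y) + (ε + (ENNReal.ofReal δ)⁻¹ * edist x y) :=
          le_add_self.trans le_add_self

theorem dependsOn_inter_setOf_one_eq {A : Set (CodeSpace E)} {I : Finset ℤ}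
    (hA : DependsOn (· ∈ A) I) (e : E) :
    DependsOn (· ∈ A ∩ {σ : CodeSpace E | σ 1 = e}) (insert 1 I : Finset ℤ) := fun σ τ h => by
  have hmem := hA fun j hj => h j (by simp [Finset.mem_coe.1 hj])
  refine congrArg₂ And hmem ?_
  rw [mem_ofPred_eq, mem_ofPred_eq, h 1 (by simp)]

theorem dependsOn_p_X (e : E) (m : ℕ) :
    DependsOn (fun σ => M.p e (M.X pt m σ)) (Finset.Icc (-(m : ℤ)) 0 : Finset ℤ) := fun σ τ h => by
  beta_reduce
  rw [dependsOn_X m h]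

theorem indicator_p_X_le_one (A : Set (CodeSpace E)) (e : E) (m : ℕ) (σ : CodeSpace E) :
    A.indicator (fun σ => ENNReal.ofReal (M.p e (M.X pt m σ))) σ ≤ 1 := by
  refine (indicator_le_self' (fun _ _ => zero_le) σ).trans ?_
  simpa using M.p_le_one e (M.X pt m σ)

theorem dependsOn_indicator_p_X {A : Set (CodeSpace E)} {I : Finset ℤ}
    (hA : DependsOn (· ∈ A) I) (e : E) (m : ℕ) :
    DependsOn (A.indicator fun σ => ENNReal.ofReal (M.p e (M.X pt m σ)))
      (I ∪ Finset.Icc (-(m : ℤ)) 0 : Finset ℤ) := by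
  rw [Finset.coe_union]
  refine dependsOn_indicator (hA.mono subset_union_left) fun σ τ h => ?_
  exact congrArg ENNReal.ofReal ((dependsOn_p_X e m).mono subset_union_right h)

variable [Countable E] {A : Set (CodeSpace E)} {I : Finset ℤ}

theorem law_inter_setOf_one_eq (hA : DependsOn (· ∈ A) I) (hI : (I : Set ℤ) ⊆ Iic 0) (e : E)
    (k : ℕ) {s : ℕ} (hs : s ≠ 0) :
    M.law pt k s (A ∩ {σ | σ 1 = e}) =
      ∫⁻ z in {z | z.2 ∈ A}, ENNReal.ofReal (M.p e z.1) ∂M.chain pt k := by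
  have hd := dependsOn_inter_setOf_one_eq hA e
  have hm := measurableSet_of_dependsOn hd
  have hAm : MeasurableSet {z : K × CodeSpace E | z.2 ∈ A} :=
    measurable_snd (measurableSet_of_dependsOn hA)
  have hone : ((insert 1 I : Finset ℤ) : Set ℤ) ⊆ Iic ((1 : ℕ) : ℤ) := by
    rw [Finset.coe_insert]
    exact insert_subset (by simp) (hI.trans (Iic_subset_Iic.2 (by simp)))
  rw [← lintegral_indicator_one hm,
    lintegral_law_of_le (measurable_one.indicator hm) (Nat.one_le_iff_ne_zero.2 hs)
      ((dependsOn_indicator_one hd).mono hone),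
    lintegral_law_succ (measurable_one.indicator hm),
    ← lintegral_indicator hAm]
  refine lintegral_congr fun z => ?_
  have hpast : ∀ e' : E, delay (0 + 1) (snoc z.2 e') ∈ A ↔ z.2 ∈ A := fun e' => by
    refine (hA fun j hj => ?_).to_iff
    rw [delay_succ_snoc_of_le (by simpa using hI hj), delay_zero]
  have hnext : ∀ e' : E, delay (0 + 1) (snoc z.2 e') 1 = e' := fun e' => by
    simpa using delay_succ_snoc_self 0 z.2 e'
  classical
  simp only [indicator_apply, mem_inter_iff, mem_ofPred_eq, hpast, hnext, OnePoint.coe_eq_coe]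
  rw [tsum_eq_single e fun e' he' => by simp [he']]
  simp

theorem lintegral_law_indicator_p_X (hA : DependsOn (· ∈ A) I) (hI : (I : Set ℤ) ⊆ Iic 0)
    (e : E) (m k s : ℕ) :
    ∫⁻ σ, A.indicator (fun σ => ENNReal.ofReal (M.p e (M.X pt m σ))) σ ∂M.law pt k s =
      ∫⁻ z in {z | z.2 ∈ A}, ENNReal.ofReal (M.p e (M.X pt m z.2)) ∂M.chain pt k := by
  rw [lintegral_law_of_past (dependsOn_indicator_p_X hA e m) (by
    rw [Finset.coe_union]
    exact union_subset hI (coe_Icc_zero_subset_Iic _))]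
  exact lintegral_indicator (measurable_snd (measurableSet_of_dependsOn hA)) _

namespace IsEdgeLimit

variable [BorelSpace K] {L : Filter ℕ} [L.NeBot] {Λ : Measure (CodeSpace E)}

theorem measure_inter_setOf_one_eq_le (h : M.IsEdgeLimit pt L Λ) (hpt : ∀ j, pt j ∈ M.part j)
    (hA : DependsOn (· ∈ A) I) (hI : (I : Set ℤ) ⊆ Iic 0) {ε B : ℝ≥0∞}
    (hB : ∀ j, ∀ x ∈ M.part j, ∀ y ∈ M.part j,
      ENNReal.ofReal (M.p e x) ≤ ENNReal.ofReal (M.p e y) + (ε + B * edist x y)) (m : ℕ) :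
    Λ (A ∩ {σ | σ 1 = e}) ≤
      ∫⁻ σ in A, ENNReal.ofReal (M.p e (M.X pt m σ)) ∂Λ + (ε + B * M.codingError pt m) := by
  have hd := dependsOn_inter_setOf_one_eq hA e
  have hm := measurableSet_of_dependsOn hd
  rw [← lintegral_indicator_one hm, ← lintegral_indicator (measurableSet_of_dependsOn hA)]
  refine h.lintegral_le_lintegral_add (dependsOn_indicator_one hd) (dependsOn_indicator_p_X hA e m)
    (indicator_le_self' (by simp)) (indicator_p_X_le_one A e m) fun k s hs => ?_
  rw [lintegral_indicator_one hm, law_inter_setOf_one_eq hA hI e k hs,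
    lintegral_law_indicator_p_X hA hI]
  refine (setLIntegral_le_setLIntegral_add (measurable_edist_window (dependsOn_X m)) ?_ _).trans
    (by gcongr; exact lintegral_edist_le_codingError m k)
  filter_upwards [ae_compatible hpt k] with z hz
  exact hB _ _ hz.1 _ (hz.2.X_mem hpt m)

theorem setLIntegral_p_X_le (h : M.IsEdgeLimit pt L Λ) (hpt : ∀ j, pt j ∈ M.part j)
    (hA : DependsOn (· ∈ A) I) (hI : (I : Set ℤ) ⊆ Iic 0) {ε B : ℝ≥0∞}
    (hB : ∀ j, ∀ x ∈ M.part j, ∀ y ∈ M.part j,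
      ENNReal.ofReal (M.p e x) ≤ ENNReal.ofReal (M.p e y) + (ε + B * edist x y)) (m : ℕ) :
    ∫⁻ σ in A, ENNReal.ofReal (M.p e (M.X pt m σ)) ∂Λ ≤
      Λ (A ∩ {σ | σ 1 = e}) + (ε + B * M.codingError pt m) := by
  have hd := dependsOn_inter_setOf_one_eq hA e
  have hm := measurableSet_of_dependsOn hd
  rw [← lintegral_indicator_one hm, ← lintegral_indicator (measurableSet_of_dependsOn hA)]
  refine h.lintegral_le_lintegral_add (dependsOn_indicator_p_X hA e m) (dependsOn_indicator_one hd)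
    (indicator_p_X_le_one A e m) (indicator_le_self' (by simp)) fun k s hs => ?_
  rw [lintegral_indicator_one hm, law_inter_setOf_one_eq hA hI e k hs,
    lintegral_law_indicator_p_X hA hI]
  refine (setLIntegral_le_setLIntegral_add (measurable_edist_window (dependsOn_X m)) ?_ _).trans
    (by gcongr; exact lintegral_edist_le_codingError m k)
  filter_upwards [ae_compatible hpt k] with z hz
  rw [edist_comm]
  exact hB _ _ (hz.2.X_mem hpt m) _ hz.1

variable [CompleteSpace K] [IsProbabilityMeasure Λ]

theorem tendsto_setLIntegral_p_X (h : M.IsEdgeLimit pt L Λ) (hpt : ∀ j, pt j ∈ M.part j)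
    (hsum : ∑' m, M.codingError pt m ≠ ∞)
    (hp : UniformContinuousOn (M.p e) (M.part (M.i e))) (A : Set (CodeSpace E)) :
    Tendsto (fun m => ∫⁻ σ in A, ENNReal.ofReal (M.p e (M.X pt m σ)) ∂Λ) atTop
      (𝓝 (∫⁻ σ in A, ENNReal.ofReal
        ((M.T (M.i e)).indicator (fun σ => M.pBar e (M.F pt σ)) σ) ∂Λ)) := by
  refine tendsto_lintegral_of_dominated_convergence (fun _ => 1)
    (fun m => (measurable_of_dependsOn (dependsOn_p_X e m)).ennreal_ofReal)
    (fun m => ae_of_all _ fun σ => by simpa using M.p_le_one e _) (by simp) ?_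
  filter_upwards [ae_restrict_of_ae (h.ae_mem_D hpt hsum)] with σ hσ
  exact ENNReal.tendsto_ofReal (tendsto_p_X hpt hp hσ)

theorem measure_inter_setOf_one_eq (h : M.IsEdgeLimit pt L Λ) (hpt : ∀ j, pt j ∈ M.part j)
    (hsum : ∑' m, M.codingError pt m ≠ ∞)
    (hp : UniformContinuousOn (M.p e) (M.part (M.i e))) (hA : DependsOn (· ∈ A) I)
    (hI : (I : Set ℤ) ⊆ Iic 0) :
    Λ (A ∩ {σ | σ 1 = e}) = ∫⁻ σ in A, ENNReal.ofReal
      ((M.T (M.i e)).indicator (fun σ => M.pBar e (M.F pt σ)) σ) ∂Λ := by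
  have hlim := h.tendsto_setLIntegral_p_X hpt hsum hp A
  have herr : ∀ (ε : ℝ≥0) (B : ℝ≥0∞), B ≠ ∞ →
      Tendsto (fun m => (ε : ℝ≥0∞) + B * M.codingError pt m) atTop (𝓝 ε) := fun ε B hB => by
    simpa using (ENNReal.Tendsto.const_mul (ENNReal.tendsto_atTop_zero_of_tsum_ne_top hsum)
      (.inr hB)).const_add (ε : ℝ≥0∞)
  refine le_antisymm ?_ ?_ <;> refine ENNReal.le_of_forall_pos_le_add fun ε hε _ => ?_ <;>
    obtain ⟨B, hB, hpB⟩ := exists_ofReal_p_le_add hp hε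
  · exact ge_of_tendsto' (hlim.add (herr ε B hB)) (h.measure_inter_setOf_one_eq_le hpt hA hI hpB)
  · exact le_of_tendsto_of_tendsto' hlim ((herr ε B hB).const_add _)
      (h.setLIntegral_p_X_le hpt hA hI hpB)

theorem condExp_ae_eq (h : M.IsEdgeLimit pt L Λ) (hpt : ∀ j, pt j ∈ M.part j)
    (hsum : ∑' m, M.codingError pt m ≠ ∞)
    (hp : UniformContinuousOn (M.p e) (M.part (M.i e))) :
    Λ[({σ : CodeSpace E | σ 1 = (e : OnePoint E)}).indicator (fun _ => (1 : ℝ)) | past E]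
      =ᵐ[Λ] (M.T (M.i e)).indicator (fun σ => M.pBar e (M.F pt σ)) := by
  have hlim : ∀ᵐ σ ∂Λ, Tendsto (fun m => M.p e (M.X pt m σ)) atTop
      (𝓝 ((M.T (M.i e)).indicator (fun σ => M.pBar e (M.F pt σ)) σ)) :=
    (h.ae_mem_D hpt hsum).mono fun σ hσ => tendsto_p_X hpt hp hσ
  refine condExp_indicator_ae_eq_of_isPiSystem past_le rfl (isPiSystem_pastCylinders E)
    (B := {σ : CodeSpace E | σ 1 = (e : OnePoint E)})
    (measurable_pi_apply (X := fun _ : ℤ => OnePoint E) 1 (.of_discrete (s := {(e : OnePoint E)})))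
    (aestronglyMeasurable_of_forall_measurable_of_tendsto_ae (fun m =>
      measurable_past_of_dependsOn (dependsOn_p_X e m) (coe_Icc_zero_subset_Iic _)) hlim) ?_ ?_ ?_
  · filter_upwards [hlim] with σ hσ
    exact ge_of_tendsto' hσ fun m => M.p_nonneg _ _
  · simpa using h.measure_inter_setOf_one_eq hpt hsum hp (A := univ) (I := ∅)
      (fun _ _ _ => rfl) (by simp)
  · rintro _ ⟨m, -, τ, rfl⟩
    exact h.measure_inter_setOf_one_eq hpt hsum hp (dependsOn_pastCylinder m τ)
      (coe_Icc_zero_subset_Iic m)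

end IsEdgeLimit

theorem asymptoticStates_nonempty [BorelSpace K] [CompleteSpace K] (hpt : ∀ j, pt j ∈ M.part j)
    (hcontr : M.Contractive) (hp : ∀ e, UniformContinuousOn (M.p e) (M.part (M.i e)))
    (hb : M.b pt < ∞) (hdom : M.HasDominatingChain) (hc : M.c < ∞) :
    (M.asymptoticStates pt).Nonempty := by
  obtain ⟨L, Λ, _, hΛ, h⟩ := exists_isEdgeLimit hpt hdom hc
  have hsum := tsum_codingError_ne_top hpt hcontr hb
  have hD : M.D pt =ᵐ[Λ] univ := eventuallyEq_univ.2 (h.ae_mem_D hpt hsum)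
  exact ⟨Λ, hΛ, h.measurePreserving_shift, by rw [measure_congr hD, measure_univ],
    fun e => h.condExp_ae_eq hpt hsum (hp e)⟩

end ConditionalLaw

end MarkovSystem

end RandomMarkov

end

theorem corollary3_general {K : Type*} [MetricSpace K] [CompleteSpace K] [MeasurableSpace K]
    [BorelSpace K] {E : Type*} [Countable E] {N : Type*} (M : RandomMarkov.MarkovSystem K E N)
    (pt : N → K) (hpt : ∀ j, pt j ∈ M.part j) (hcontr : M.Contractive)
    (hp : ∀ e, UniformContinuousOn (M.p e) (M.part (M.i e))) (hcons : M.Consistent pt)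
    (hb : M.b pt < ∞) (hdom : M.HasDominatingChain) (hc : M.c < ∞) :
    M.invariantMeasures.Nonempty := by
  obtain ⟨Λ, hΛ⟩ :=
    RandomMarkov.MarkovSystem.asymptoticStates_nonempty hpt hcontr hp hb hdom hc
  exact ⟨Λ.map (M.F pt), hcons Λ hΛ⟩

theorem corollary3 {K : Type*} [MetricSpace K] [CompleteSpace K] [MeasurableSpace K] [BorelSpace K]
    {E : Type*} [Countable E] {N : Type*} [Countable N]
    (M : RandomMarkov.MarkovSystem K E N)
    (pt : N → K) (hpt : ∀ j, pt j ∈ M.part j)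
    (hcontr : M.Contractive)
    (huc : M.IsUniformlyContinuous)
    (hcons : M.Consistent pt)
    (hb : M.b pt < ∞)
    (hdom : M.HasDominatingChain) :
    (M.c < ∞ → M.invariantMeasures.Nonempty) ∧
      (Finite N → M.invariantMeasures.Nonempty) := by
  have h := corollary3_general M pt hpt hcontr (fun e => (huc e).2) hcons hb hdom
  exact ⟨h, fun _ => h (RandomMarkov.MarkovSystem.c_lt_top_of_finite hdom)⟩
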